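/- Let $\lambda$ be Lebesgue measure on $[0,1]$; "measurable" means Lebesgue measurable. A \emph{graphon} is a measurable function $U:[0,1]^2\to[0,1]$ with $U(x,y)=U(y,x)$ for all $x,y$. Let $k\ge 1$ be an integer. A \emph{$k$-coloured graphon} is a pair $(U,\mathcal A)$ where $U$ is a graphon and $\mathcal A=(A_1,\dots,A_k)$ is an ordered partition of $[0,1]$ into $k$ measurable (possibly empty) sets. For $k$-coloured graphons $(U,\mathcal A)$ and $(V,\mathcal B)$ put $$d^{(k)}_\Box((U,\mathcal A),(V,\mathcal B)):=\sup_{C,D\subseteq[0,1]}\ \sum_{i,j=1}^k\left|\int_{C\times D}\left(\mathbf 1_{A_i\times A_j}U-\mathbf 1_{B_i\times B_j}V\right)\mathrm d\lambda^{2}\right|+\sum_{i=1}^k\lambda(A_i\triangle B_i),$$ where the supremum is over measurable sets $C,D$, and $$\delta^{(k)}_\Box((U,\mathcal A),(V,\mathcal B)):=\inf_{\phi,\psi}d^{(k)}_\Box\big((U^\phi,\mathcal A^\phi),(V^\psi,\mathcal B^\psi)\big),$$ where the infimum is over all measure-preserving maps $\phi,\psi:[0,1]\to[0,1]$, $U^\phi(x,y):=U(\phi(x),\phi(y))$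 and $\mathcal A^\phi:=(\phi^{-1}(A_1),\dots,\phi^{-1}(A_k))$. **Theorem.** For every integer $k\ge1$, $\delta^{(k)}_\Box$ is a pseudo-metric on the set of $k$-coloured graphons, and the metric space obtained from it by identifying $k$-coloured graphons at $\delta^{(k)}_\Box$-distance $0$ is compact. -/

import Mathlib

open MeasureTheory Set
open scoped unitInterval symmDiff

/-- A graphon: a symmetric, Lebesgue measurable function `[0,1]² → [0,1]`.  Here
`NullMeasurable _ volume` is measurability with respect to the completed (Lebesgue) σ-algebra. -/
structure Graphon where
  toFun : I → I → ℝ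
  mem_Icc : ∀ x y, toFun x y ∈ Icc (0 : ℝ) 1
  symm : ∀ x y, toFun x y = toFun y x
  measurable : NullMeasurable (fun p : I × I => toFun p.1 p.2) volume

/-- An ordered partition of `[0,1]` into `k` Lebesgue measurable (possibly empty) parts. -/
structure MeasPartition (k : ℕ) where
  part : Fin k → Set I
  measurable : ∀ i, NullMeasurableSet (part i) volume
  disjoint : ∀ i j, i ≠ j → Disjoint (part i) (part j)
  cover : ⋃ i, part i = univ

/-- A `k`-coloured graphon: a graphon with an ordered measurable `k`-partition of `[0,1]`. -/
structure ColouredGraphon (k : ℕ) where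
  graphon : Graphon
  partition : MeasPartition k

/-- Measure-preserving maps `[0,1] → [0,1]` (for the Lebesgue σ-algebra): preimages of Lebesgue
measurable sets are Lebesgue measurable and have the same measure. -/
def IsMeasPres (φ : I → I) : Prop :=
  ∀ s : Set I, NullMeasurableSet s volume →
    NullMeasurableSet (φ ⁻¹' s) volume ∧ volume (φ ⁻¹' s) = volume s

/-- The type of measure-preserving maps `[0,1] → [0,1]`. -/
abbrev MeasPresMap : Type := {φ : I → I // IsMeasPres φ}

/-- The type of Lebesgue measurable subsets of `[0,1]`. -/
abbrev LebSet : Type := {s : Set I // NullMeasurableSet s volume}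

theorem IsMeasPres.nullMeasurable_pullback {φ : I → I} (h : IsMeasPres φ) {f : I × I → ℝ}
    (hf : NullMeasurable f volume) :
    NullMeasurable (fun p : I × I => f (φ p.1, φ p.2)) volume := by
  have hφ : AEMeasurable φ volume :=
    NullMeasurable.aemeasurable fun s hs => (h s hs.nullMeasurableSet).1
  have hmap : Measure.map φ volume = volume := by
    ext s hs
    rw [Measure.map_apply_of_aemeasurable hφ hs, (h s hs.nullMeasurableSet).2]
  have hmp : MeasurePreserving (hφ.mk φ) volume volume :=
    ⟨hφ.measurable_mk, by rw [← Measure.map_congr hφ.ae_eq_mk, hmap]⟩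
  have hq := (hmp.prod hmp).quasiMeasurePreserving
  have h1 : NullMeasurable (f ∘ Prod.map (hφ.mk φ) (hφ.mk φ)) (volume : Measure (I × I)) :=
    fun s hs => (hf hs).preimage hq
  refine h1.congr ?_
  have e1 := (Measure.quasiMeasurePreserving_fst (μ := (volume : Measure I))
    (ν := (volume : Measure I))).ae_eq_comp hφ.ae_eq_mk
  have e2 := (Measure.quasiMeasurePreserving_snd (μ := (volume : Measure I))
    (ν := (volume : Measure I))).ae_eq_comp hφ.ae_eq_mk
  filter_upwards [e1, e2] with p h1 h2
  simp only [Function.comp_apply] at h1 h2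
  simp [Prod.map, h1, h2]

/-- The pull-back `U^φ(x,y) = U(φ(x),φ(y))` of a graphon. -/
def Graphon.pullback (U : Graphon) (φ : MeasPresMap) : Graphon where
  toFun x y := U.toFun (φ.1 x) (φ.1 y)
  mem_Icc _ _ := U.mem_Icc _ _
  symm _ _ := U.symm _ _
  measurable := φ.2.nullMeasurable_pullback U.measurable

/-- The pull-back `𝒜^φ = (φ⁻¹(A₁),…,φ⁻¹(A_k))` of a partition. -/
def MeasPartition.pullback {k : ℕ} (A : MeasPartition k) (φ : MeasPresMap) :
    MeasPartition k where
  part i := φ.1 ⁻¹' A.part i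
  measurable i := (φ.2 _ (A.measurable i)).1
  disjoint i j hij := (A.disjoint i j hij).preimage _
  cover := by rw [← preimage_iUnion, A.cover, preimage_univ]

/-- The pull-back `(U,𝒜)^φ = (U^φ,𝒜^φ)` of a coloured graphon. -/
def ColouredGraphon.pullback {k : ℕ} (X : ColouredGraphon k) (φ : MeasPresMap) :
    ColouredGraphon k where
  graphon := X.graphon.pullback φ
  partition := X.partition.pullback φ

/-- The function `1_{A_i × A_j} U` on `[0,1]²`. -/
noncomputable def ColouredGraphon.block {k : ℕ} (X : ColouredGraphon k) (i j : Fin k) :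
    I × I → ℝ :=
  (X.partition.part i ×ˢ X.partition.part j).indicator fun p => X.graphon.toFun p.1 p.2

/-- The distance `d_□^{(k)}` on `k`-coloured graphons:
`sup_{C,D} ∑_{i,j} |∫_{C×D} (1_{A_i×A_j} U - 1_{B_i×B_j} V)| + ∑_i λ(A_i △ B_i)`. -/
noncomputable def colouredCutNormDist {k : ℕ} (X Y : ColouredGraphon k) : ℝ :=
  (⨆ CD : LebSet × LebSet, ∑ i : Fin k, ∑ j : Fin k,
      |∫ p in CD.1.1 ×ˢ CD.2.1, (X.block i j p - Y.block i j p)|) +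
    ∑ i : Fin k, (volume (X.partition.part i ∆ Y.partition.part i)).toReal

/-- The cut-distance `δ_□^{(k)}` of `k`-coloured graphons: the infimum of `d_□^{(k)}(X^φ, Y^ψ)`
over all measure-preserving maps `φ, ψ : [0,1] → [0,1]`. -/
noncomputable def colouredCutDist {k : ℕ} (X Y : ColouredGraphon k) : ℝ :=
  ⨅ φψ : MeasPresMap × MeasPresMap,
    colouredCutNormDist (X.pullback φψ.1) (Y.pullback φψ.2)

/-- The quotient of the set of `k`-coloured graphons identifying pairs at `δ_□^{(k)}`-distance
`0`. -/
def ColouredGraphonQuotient (k : ℕ) : Type :=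
  Quot fun X Y : ColouredGraphon k => colouredCutDist X Y = 0

/-- The class of a `k`-coloured graphon in the quotient. -/
def ColouredGraphon.toQuotient {k : ℕ} (X : ColouredGraphon k) : ColouredGraphonQuotient k :=
  Quot.mk _ X

/-!
The infimum defining `δ_□^{(k)}` runs over pairs `(φ, ψ)` of measure-preserving maps, but
`d_□^{(k)}(X^φ, Y^ψ)` depends only on the joint law of `(φ, ψ)`, a coupling of Lebesgue measure with
itself (`colouredCutNormDist_pullback_le_of_law_eq`). The reason is that, for given signs of the
integrals, the best sets `C` and `D` are sets where a function of `(φ, ψ)` is nonnegative, so the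
supremum may be computed on the space of values of `(φ, ψ)` (`sum_abs_setIntegral_comp_le`).
Conversely every coupling is the law of some `(φ, ψ)`. Couplings of consecutive members of a
sequence of coloured graphons can be glued (`exists_measurePreserving_chain`), so that the sequence
is realised on one copy of `[0,1]` with almost optimal consecutive distances
(`exists_pullback_chain`).
Applied to three coloured graphons, this is the triangle inequality. Compactness is completeness
together with total boundedness.

*Completeness.* After gluing, a rapidly Cauchy sequence for `δ_□^{(k)}` becomes one for `d_□^{(k)}`.
Its colourings converge by a Borel-Cantelli argument (`MeasPartition.exists_limit`), and its
graphons have a weak limit along an ultrafilter (`Graphon.exists_weak_limit`). The cut norm is lower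
semicontinuous under weak convergence, so that the Cauchy condition gives convergence to the limit
(`exists_colouredCutNormDist_limit`).

*Total boundedness.* By greedy subtraction of rectangles with coefficients `±ε`, each of which
lowers the `L²` energy by at least `ε²`, every graphon is within `ε` in cut norm of a step
function whose matrix of values comes from a finite list (`exists_step_approximation`). If two
coloured graphons share that matrix and the measures of the parts of their joint partitions
by colour and step nearly agree, then a maximal coupling makes these partitions agree off a small set,
and the two are close
(`exists_finite_discretization`).
-/

/-! ### Couplings -/

/-- A coupling `γ` of Lebesgue measure with a second law is the law of `(x, g (x, u))` for
independent uniform `x` and `u`: disintegrate `γ` and represent its conditional kernel by a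
uniform variable. -/
theorem exists_measurePreserving_prod_of_map_fst (γ : Measure (I × I)) [IsProbabilityMeasure γ]
    (h : γ.map Prod.fst = volume) :
    ∃ g : I × I → I, Measurable g ∧
      MeasurePreserving (fun p : I × I => (p.1, g p)) volume γ := by
  obtain ⟨f, hf, hfκ⟩ :=
    ProbabilityTheory.Kernel.exists_measurable_map_eq_unitInterval γ.condKernel
  refine ⟨Function.uncurry f, hf, by fun_prop, ?_⟩
  have hγ : (volume : Measure I).compProd γ.condKernel = γ := by
    have h1 := γ.disintegrate γ.condKernel
    rwa [Measure.fst, h] at h1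
  have hm : Measurable fun p : I × I => (p.1, Function.uncurry f p) := by fun_prop
  ext s hs
  rw [Measure.map_apply hm hs, ← hγ, Measure.compProd_apply hs]
  rw [show (volume : Measure (I × I)) = (volume : Measure I).prod volume from rfl,
    Measure.prod_apply (hm hs)]
  refine lintegral_congr fun a => ?_
  rw [← hfκ a, Measure.map_apply (by fun_prop) (measurable_prodMk_left hs)]
  rfl

/-- Gluing of couplings: a sequence of couplings of Lebesgue measure with itself is realised by
consecutive pairs of one sequence of maps `[0,1] → [0,1]`. The state carried along the recursion is
a pair consisting of the current point and of an independent uniform variable; at each step that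
variable is split into two independent uniform variables, one to be used and one to be kept. -/
theorem exists_measurePreserving_chain (γ : ℕ → Measure (I × I))
    (h₁ : ∀ n, (γ n).map Prod.fst = volume) (h₂ : ∀ n, (γ n).map Prod.snd = volume) :
    ∃ Z : ℕ → I → I, (∀ n, MeasurePreserving (Z n) volume volume) ∧
      ∀ n, MeasurePreserving (fun x => (Z n x, Z (n + 1) x)) volume (γ n) := by
  have hprob : ∀ n, IsProbabilityMeasure (γ n) := fun n => by
    have : IsProbabilityMeasure ((γ n).map Prod.fst) := by rw [h₁ n]; infer_instance
    exact Measure.isProbabilityMeasure_of_map Prod.fst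
  choose g hg hgγ using fun n => exists_measurePreserving_prod_of_map_fst (γ n) (h₁ n)
  obtain ⟨S, hS, hSv⟩ := (volume : Measure (I × I)).exists_measurable_map_eq
  have hSmp : MeasurePreserving S volume volume := ⟨hS, hSv⟩
  have hgmp : ∀ n, MeasurePreserving (g n) volume volume := fun n =>
    (⟨measurable_snd, h₂ n⟩ : MeasurePreserving Prod.snd (γ n) volume).comp (hgγ n)
  -- one step of the recursion: use `(S p.2).1` as randomness, keep `(S p.2).2`
  let G : ℕ → I × I → I × I := fun n p => (g n (p.1, (S p.2).1), (S p.2).2)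
  have hsplit : MeasurePreserving (fun p : I × I => ((p.1, (S p.2).1), (S p.2).2))
      volume (volume : Measure ((I × I) × I)) := by
    have h1 := (MeasurePreserving.id (volume : Measure I)).prod hSmp
    exact (volume_preserving_prodAssoc (α₁ := I) (β₁ := I) (γ₁ := I)).symm.comp h1
  have hG : ∀ n, MeasurePreserving (G n) volume volume := fun n =>
    ((hgmp n).prod (MeasurePreserving.id (volume : Measure I))).comp hsplit
  let T : ℕ → I → I × I := fun n => Nat.rec S (fun n t => G n ∘ t) n
  have hT : ∀ n, MeasurePreserving (T n) volume volume := fun n => by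
    induction n with
    | zero => exact hSmp
    | succ n ih => exact (hG n).comp ih
  have hfst : MeasurePreserving (Prod.fst : I × I → I) volume volume := measurePreserving_fst
  refine ⟨fun n => Prod.fst ∘ T n, fun n => hfst.comp (hT n), fun n => ?_⟩
  have hfst' : MeasurePreserving (Prod.fst : (I × I) × I → I × I) volume volume :=
    measurePreserving_fst
  exact (((hgγ n).comp hfst').comp hsplit).comp (hT n)

/-- A partial coupling is completed to a coupling by adding a multiple of the product of the
missing marginals. -/
theorem exists_coupling_ge {α β : Type*} [MeasurableSpace α] [MeasurableSpace β]
    (μ : Measure α) (ν : Measure β) [IsProbabilityMeasure μ] [IsProbabilityMeasure ν]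
    (γ₀ : Measure (α × β)) (h₁ : γ₀.map Prod.fst ≤ μ) (h₂ : γ₀.map Prod.snd ≤ ν) :
    ∃ γ : Measure (α × β), γ₀ ≤ γ ∧ γ.map Prod.fst = μ ∧ γ.map Prod.snd = ν := by
  have hf₁ : IsFiniteMeasure (γ₀.map Prod.fst) := isFiniteMeasure_of_le μ h₁
  have hf₂ : IsFiniteMeasure (γ₀.map Prod.snd) := isFiniteMeasure_of_le ν h₂
  have hm₁ : γ₀.map Prod.fst univ = γ₀ univ := by
    rw [Measure.map_apply measurable_fst .univ, preimage_univ]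
  have hm₂ : γ₀.map Prod.snd univ = γ₀ univ := by
    rw [Measure.map_apply measurable_snd .univ, preimage_univ]
  set δ := 1 - γ₀ univ with hδ
  have ha : (μ - γ₀.map Prod.fst) univ = δ := by
    rw [Measure.sub_apply .univ h₁, measure_univ, hm₁]
  have hb : (ν - γ₀.map Prod.snd) univ = δ := by
    rw [Measure.sub_apply .univ h₂, measure_univ, hm₂]
  have hδt : δ ≠ ⊤ := by rw [hδ]; exact ENNReal.sub_ne_top ENNReal.one_ne_top
  by_cases h0 : δ = 0
  · refine ⟨γ₀, le_rfl, ?_, ?_⟩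
    · rw [← Measure.sub_add_cancel_of_le h₁, Measure.measure_univ_eq_zero.1 (ha.trans h0), zero_add]
    · rw [← Measure.sub_add_cancel_of_le h₂, Measure.measure_univ_eq_zero.1 (hb.trans h0), zero_add]
  · refine ⟨γ₀ + δ⁻¹ • (μ - γ₀.map Prod.fst).prod (ν - γ₀.map Prod.snd),
      Measure.le_add_right le_rfl, ?_, ?_⟩
    · rw [Measure.map_add _ _ measurable_fst, Measure.map_smul, Measure.map_fst_prod, hb, smul_smul,
        ENNReal.inv_mul_cancel h0 hδt, one_smul, add_comm, Measure.sub_add_cancel_of_le h₁]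
    · rw [Measure.map_add _ _ measurable_snd, Measure.map_smul, Measure.map_snd_prod, ha, smul_smul,
        ENNReal.inv_mul_cancel h0 hδt, one_smul, add_comm, Measure.sub_add_cancel_of_le h₂]

/-- The maximal coupling for finitely valued maps: `p` and `q` can be made to agree with probability
at least the overlap of their laws. -/
theorem exists_coupling_of_finite {α β τ : Type*} [MeasurableSpace α] [MeasurableSpace β]
    [Fintype τ] (μ : Measure α) (ν : Measure β) [IsProbabilityMeasure μ] [IsProbabilityMeasure ν]
    (p : α → τ) (q : β → τ) (hp : ∀ a, NullMeasurableSet (p ⁻¹' {a}) μ)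
    (hq : ∀ a, NullMeasurableSet (q ⁻¹' {a}) ν) :
    ∃ γ : Measure (α × β), γ.map Prod.fst = μ ∧ γ.map Prod.snd = ν ∧
      γ {z | p z.1 ≠ q z.2} ≤ 1 - ∑ a, min (μ (p ⁻¹' {a})) (ν (q ⁻¹' {a})) := by
  classical
  set P := fun a => μ (p ⁻¹' {a}) with hP
  set Q := fun a => ν (q ⁻¹' {a}) with hQ
  -- mass `P a * Q a / max (P a) (Q a) = min (P a) (Q a)` is put on `{p = a} × {q = a}`
  let γ₀ : Measure (α × β) := Measure.sum fun a =>
    (max (P a) (Q a))⁻¹ • (μ.restrict (p ⁻¹' {a})).prod (ν.restrict (q ⁻¹' {a}))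
  have hle : ∀ x y : ENNReal, x ≤ y → y⁻¹ * x ≤ 1 := fun x y h =>
    (mul_le_mul_right h _).trans (ENNReal.inv_mul_le_one _)
  have hsum₁ : Measure.sum (fun a => μ.restrict (p ⁻¹' {a})) = μ := by
    rw [← Measure.restrict_iUnion_ae _ hp, ← preimage_iUnion, iUnion_of_singleton, preimage_univ,
      Measure.restrict_univ]
    exact fun a b hab => ((disjoint_singleton.2 hab).preimage p).aedisjoint
  have hsum₂ : Measure.sum (fun a => ν.restrict (q ⁻¹' {a})) = ν := by
    rw [← Measure.restrict_iUnion_ae _ hq, ← preimage_iUnion, iUnion_of_singleton, preimage_univ,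
      Measure.restrict_univ]
    exact fun a b hab => ((disjoint_singleton.2 hab).preimage q).aedisjoint
  have h₁ : γ₀.map Prod.fst ≤ μ := by
    conv_rhs => rw [← hsum₁]
    rw [Measure.map_sum measurable_fst.aemeasurable]
    refine Measure.le_iff.2 fun s hs => ?_
    rw [Measure.sum_apply _ hs, Measure.sum_apply _ hs]
    refine ENNReal.tsum_le_tsum fun a => Measure.le_iff'.1 ?_ s
    rw [Measure.map_smul, Measure.map_fst_prod, Measure.restrict_apply_univ, smul_smul]
    exact Measure.le_iff'.2 fun t => mul_le_of_le_one_left' (hle _ _ (le_max_right _ _))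
  have h₂ : γ₀.map Prod.snd ≤ ν := by
    conv_rhs => rw [← hsum₂]
    rw [Measure.map_sum measurable_snd.aemeasurable]
    refine Measure.le_iff.2 fun s hs => ?_
    rw [Measure.sum_apply _ hs, Measure.sum_apply _ hs]
    refine ENNReal.tsum_le_tsum fun a => Measure.le_iff'.1 ?_ s
    rw [Measure.map_smul, Measure.map_snd_prod, Measure.restrict_apply_univ, smul_smul]
    exact Measure.le_iff'.2 fun t => mul_le_of_le_one_left' (hle _ _ (le_max_left _ _))
  obtain ⟨γ, hγ, hγ₁, hγ₂⟩ := exists_coupling_ge μ ν γ₀ h₁ h₂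
  refine ⟨γ, hγ₁, hγ₂, ?_⟩
  have hprob : IsProbabilityMeasure γ := by
    have : IsProbabilityMeasure (γ.map Prod.fst) := by rw [hγ₁]; infer_instance
    exact Measure.isProbabilityMeasure_of_map Prod.fst
  have hEm : NullMeasurableSet {z : α × β | p z.1 = q z.2} γ := by
    have : {z : α × β | p z.1 = q z.2} =
        ⋃ a, Prod.fst ⁻¹' (p ⁻¹' {a}) ∩ Prod.snd ⁻¹' (q ⁻¹' {a}) := by
      ext z; simp [eq_comm]
    rw [this]
    refine NullMeasurableSet.iUnion fun a => NullMeasurableSet.inter ?_ ?_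
    · exact (hp a).preimage (MeasurePreserving.quasiMeasurePreserving ⟨measurable_fst, hγ₁⟩)
    · exact (hq a).preimage (MeasurePreserving.quasiMeasurePreserving ⟨measurable_snd, hγ₂⟩)
  have hcompl : {z : α × β | p z.1 ≠ q z.2} = {z : α × β | p z.1 = q z.2}ᶜ := rfl
  rw [hcompl, prob_compl_eq_one_sub₀ hEm]
  refine tsub_le_tsub_left ?_ 1
  refine le_trans ?_ (hγ _)
  refine le_trans ?_ (Measure.le_sum_apply _ _)
  rw [tsum_fintype]
  refine Finset.sum_le_sum fun a _ => ?_
  have hsub : (p ⁻¹' {a}) ×ˢ (q ⁻¹' {a}) ⊆ {z : α × β | p z.1 = q z.2} := by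
    rintro ⟨x, y⟩ ⟨hx, hy⟩
    exact hx.trans hy.symm
  rw [Measure.smul_apply]
  refine le_trans ?_ (smul_le_smul_left _ (measure_mono hsub))
  rw [Measure.prod_prod, Measure.restrict_apply_self, Measure.restrict_apply_self, smul_eq_mul]
  change min (P a) (Q a) ≤ (max (P a) (Q a))⁻¹ * (P a * Q a)
  rw [← max_mul_min (P a) (Q a)]
  rcases eq_or_ne (max (P a) (Q a)) 0 with h0 | h0
  · rw [(min_le_max.trans h0.le).antisymm zero_le]
    exact zero_le
  · have ht : max (P a) (Q a) ≠ ⊤ := (max_lt (measure_lt_top _ _) (measure_lt_top _ _)).ne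
    rw [← mul_assoc, ENNReal.inv_mul_cancel h0 ht, one_mul]

/-! ### Cut norms and measure-preserving maps -/

section
variable {Ω S : Type*} [MeasurableSpace Ω] [MeasurableSpace S] {μ : Measure Ω} {γ : Measure S}

/-- The set maximising `∫_C h ∘ T` is `{h ∘ T ≥ 0}`, which is a preimage under `T`. -/
theorem exists_setIntegral_comp_le {T : Ω → S} (hT : MeasurePreserving T μ γ) {h : S → ℝ}
    (hh : Integrable h γ) {C : Set Ω} (hC : NullMeasurableSet C μ) :
    ∃ C' : Set S, MeasurableSet C' ∧ ∫ x in C, h (T x) ∂μ ≤ ∫ z in C', h z ∂γ := by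
  obtain ⟨g, hg, hgh⟩ := hh.aestronglyMeasurable
  have hC' : MeasurableSet {z | 0 ≤ g z} := measurableSet_le measurable_const hg.measurable
  refine ⟨{z | 0 ≤ g z}, hC', ?_⟩
  have hgi : Integrable g γ := hh.congr hgh
  have hgT : Integrable (fun x => g (T x)) μ := hT.integrable_comp_of_integrable hgi
  have e : ∀ᵐ x ∂μ, h (T x) = g (T x) := hT.quasiMeasurePreserving.ae_eq_comp hgh
  rw [setIntegral_congr_ae₀ hC (e.mono fun x hx _ => hx),
    setIntegral_congr_ae hC' (hgh.mono fun x hx _ => hx)]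
  rw [← hT.map_eq, setIntegral_map hC' (by rw [hT.map_eq]; exact hgi.1) hT.measurable.aemeasurable,
    ← integral_indicator₀ hC, ← integral_indicator (hT.measurable hC')]
  refine integral_mono (hgT.indicator₀ hC) (hgT.indicator (hT.measurable hC')) fun x => ?_
  simp only [indicator, mem_preimage, mem_ofPred_eq]
  split_ifs <;> linarith

variable [IsProbabilityMeasure μ] [IsProbabilityMeasure γ]

/-- One factor at a time, the rectangle `C × D` is replaced by a better one, pulled back
along `T`. -/
theorem exists_setIntegral_prod_comp_le {T : Ω → S} (hT : MeasurePreserving T μ γ)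
    {H : S × S → ℝ} (hH : Integrable H (γ.prod γ)) {C D : Set Ω} (hC : NullMeasurableSet C μ)
    (hD : NullMeasurableSet D μ) :
    ∃ C' D' : Set S, MeasurableSet C' ∧ MeasurableSet D' ∧
      ∫ p in C ×ˢ D, H (T p.1, T p.2) ∂(μ.prod μ) ≤ ∫ p in C' ×ˢ D', H p ∂(γ.prod γ) := by
  have hTT : Integrable (fun p : Ω × Ω => H (T p.1, T p.2)) (μ.prod μ) :=
    (hT.prod hT).integrable_comp_of_integrable hH
  have hidT : Integrable (fun p : S × Ω => H (p.1, T p.2)) (γ.prod μ) :=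
    ((MeasurePreserving.id γ).prod hT).integrable_comp_of_integrable hH
  have h1 : Integrable (fun z => ∫ y in D, H (z, T y) ∂μ) γ :=
    (hidT.mono_measure (Measure.prod_mono le_rfl Measure.restrict_le_self)).integral_prod_left
  obtain ⟨C', hC', hle⟩ := exists_setIntegral_comp_le hT h1 hC
  have h2 : Integrable (fun w => ∫ z in C', H (z, w) ∂γ) γ :=
    (hH.mono_measure (Measure.prod_mono Measure.restrict_le_self le_rfl)).integral_prod_right
  obtain ⟨D', hD', hle'⟩ := exists_setIntegral_comp_le hT h2 hD
  refine ⟨C', D', hC', hD', ?_⟩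
  rw [setIntegral_prod _ hTT.integrableOn]
  refine hle.trans ?_
  have hr : Integrable (fun p : S × Ω => H (p.1, T p.2)) ((γ.restrict C').prod (μ.restrict D)) := by
    rw [Measure.prod_restrict]
    exact hidT.integrableOn
  rw [integral_integral_swap (f := fun z y => H (z, T y)) hr]
  refine hle'.trans (le_of_eq ?_)
  rw [← Measure.prod_restrict, integral_prod_symm]
  rw [Measure.prod_restrict]
  exact hH.integrableOn

/-- Pulling back along a measure-preserving map does not increase a cut norm. With the signs of the
integrals fixed, the sum of absolute values is the integral of a single kernel. -/
theorem sum_abs_setIntegral_comp_le {ι : Type*} [Fintype ι] {T : Ω → S}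
    (hT : MeasurePreserving T μ γ) {F : ι → S × S → ℝ} (hF : ∀ i, Integrable (F i) (γ.prod γ))
    {B : ℝ} (hB : ∀ C D, MeasurableSet C → MeasurableSet D →
      ∑ i, |∫ p in C ×ˢ D, F i p ∂(γ.prod γ)| ≤ B) {C D : Set Ω} (hC : NullMeasurableSet C μ)
    (hD : NullMeasurableSet D μ) :
    ∑ i, |∫ p in C ×ˢ D, F i (T p.1, T p.2) ∂(μ.prod μ)| ≤ B := by
  let s : ι → ℝ := fun i => SignType.sign (∫ p in C ×ˢ D, F i (T p.1, T p.2) ∂(μ.prod μ))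
  obtain ⟨C', D', hC', hD', hle⟩ := exists_setIntegral_prod_comp_le hT
    (H := fun p => ∑ i, s i * F i p) (integrable_finsetSum _ fun i _ => (hF i).const_mul _) hC hD
  have hFT : ∀ i, Integrable (fun p : Ω × Ω => F i (T p.1, T p.2)) (μ.prod μ) := fun i =>
    (hT.prod hT).integrable_comp_of_integrable (hF i)
  rw [integral_finsetSum _ fun i _ => ((hFT i).const_mul _).integrableOn,
    integral_finsetSum _ fun i _ => ((hF i).const_mul _).integrableOn] at hle
  simp_rw [integral_const_mul] at hle
  refine le_trans (Finset.sum_le_sum fun i _ => ?_) (hle.trans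
    ((Finset.sum_le_sum fun i _ => ?_).trans (hB C' D' hC' hD')))
  · exact (sign_mul_self _).ge
  · refine (le_abs_self _).trans ?_
    rw [abs_mul]
    refine mul_le_of_le_one_left (abs_nonneg _) ?_
    simp only [s]
    rcases SignType.sign (∫ p in C ×ˢ D, F i (T p.1, T p.2) ∂(μ.prod μ)) <;> simp
end

/-! ### Measure-preserving maps of `[0,1]` -/

theorem MeasureTheory.MeasurePreserving.isMeasPres {φ : I → I}
    (h : MeasurePreserving φ volume volume) : IsMeasPres φ := fun _ hs =>
  ⟨hs.preimage h.quasiMeasurePreserving, h.measure_preimage hs⟩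

theorem IsMeasPres.aemeasurable {φ : I → I} (h : IsMeasPres φ) : AEMeasurable φ volume :=
  NullMeasurable.aemeasurable fun s hs => (h s hs.nullMeasurableSet).1

theorem IsMeasPres.map_eq {φ : I → I} (h : IsMeasPres φ) : Measure.map φ volume = volume := by
  ext s hs
  rw [Measure.map_apply_of_aemeasurable h.aemeasurable hs, (h s hs.nullMeasurableSet).2]

/-- The identity as a measure-preserving map. -/
def MeasPresMap.id : MeasPresMap := ⟨fun x => x, fun _ hs => ⟨hs, rfl⟩⟩

instance : Nonempty MeasPresMap := ⟨MeasPresMap.id⟩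

namespace MeasPresMap

/-- The joint law of two measure-preserving maps: a coupling of Lebesgue measure with itself. -/
noncomputable def law (φ ψ : MeasPresMap) : Measure (I × I) :=
  Measure.map (fun x => (φ.1 x, ψ.1 x)) volume

theorem aemeasurable_prodMk (φ ψ : MeasPresMap) :
    AEMeasurable (fun x => (φ.1 x, ψ.1 x)) volume :=
  φ.2.aemeasurable.prodMk ψ.2.aemeasurable

instance (φ ψ : MeasPresMap) : IsProbabilityMeasure (law φ ψ) :=
  Measure.isProbabilityMeasure_map (aemeasurable_prodMk φ ψ)

theorem map_fst_law (φ ψ : MeasPresMap) : (law φ ψ).map Prod.fst = volume := by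
  rw [law, AEMeasurable.map_map_of_aemeasurable measurable_fst.aemeasurable
    (aemeasurable_prodMk φ ψ)]
  exact φ.2.map_eq

theorem map_snd_law (φ ψ : MeasPresMap) : (law φ ψ).map Prod.snd = volume := by
  rw [law, AEMeasurable.map_map_of_aemeasurable measurable_snd.aemeasurable
    (aemeasurable_prodMk φ ψ)]
  exact ψ.2.map_eq

theorem exists_ae_eq_measurePreserving (φ ψ : MeasPresMap) :
    ∃ T : I → I × I, MeasurePreserving T volume (law φ ψ) ∧
      ∀ᵐ x, (φ.1 x, ψ.1 x) = T x :=
  ⟨(aemeasurable_prodMk φ ψ).mk _, ⟨(aemeasurable_prodMk φ ψ).measurable_mk,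
    (Measure.map_congr (aemeasurable_prodMk φ ψ).ae_eq_mk).symm⟩,
    (aemeasurable_prodMk φ ψ).ae_eq_mk⟩

theorem exists_law_eq (γ : Measure (I × I)) (h₁ : γ.map Prod.fst = volume)
    (h₂ : γ.map Prod.snd = volume) : ∃ φ ψ : MeasPresMap, law φ ψ = γ := by
  have hprob : IsProbabilityMeasure γ := by
    have : IsProbabilityMeasure (γ.map Prod.fst) := by rw [h₁]; infer_instance
    exact Measure.isProbabilityMeasure_of_map Prod.fst
  obtain ⟨T, hT, hTγ⟩ := γ.exists_measurable_map_eq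
  have hT' : MeasurePreserving T volume γ := ⟨hT, hTγ⟩
  exact ⟨⟨_, ((⟨measurable_fst, h₁⟩ : MeasurePreserving Prod.fst γ volume).comp hT').isMeasPres⟩,
    ⟨_, ((⟨measurable_snd, h₂⟩ : MeasurePreserving Prod.snd γ volume).comp hT').isMeasPres⟩, hTγ⟩

theorem exists_chain (φ ψ : ℕ → MeasPresMap) :
    ∃ Z : ℕ → MeasPresMap, ∀ n, law (Z n) (Z (n + 1)) = law (φ n) (ψ n) := by
  obtain ⟨Z, hZ, hZγ⟩ := exists_measurePreserving_chain (fun n => law (φ n) (ψ n))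
    (fun n => map_fst_law _ _) (fun n => map_snd_law _ _)
  exact ⟨fun n => ⟨Z n, (hZ n).isMeasPres⟩, fun n => (hZγ n).map_eq⟩

end MeasPresMap

/-! ### Blocks of coloured graphons -/

section
variable {k : ℕ}

theorem Graphon.integrable (U : Graphon) :
    Integrable (fun p : I × I => U.toFun p.1 p.2) volume :=
  Integrable.of_bound U.measurable.aemeasurable.aestronglyMeasurable 1
    (Filter.Eventually.of_forall fun p => by
      rw [Real.norm_eq_abs, abs_le]
      exact ⟨by linarith [(U.mem_Icc p.1 p.2).1], (U.mem_Icc p.1 p.2).2⟩)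

namespace ColouredGraphon

theorem block_mem_Icc (X : ColouredGraphon k) (i j : Fin k) (p : I × I) :
    X.block i j p ∈ Icc (0 : ℝ) 1 := by
  unfold block
  by_cases h : p ∈ X.partition.part i ×ˢ X.partition.part j
  · rw [indicator_of_mem h]; exact X.graphon.mem_Icc _ _
  · rw [indicator_of_notMem h]; simp

theorem nullMeasurableSet_prod (X : ColouredGraphon k) (i j : Fin k) :
    NullMeasurableSet (X.partition.part i ×ˢ X.partition.part j) (volume : Measure (I × I)) :=
  (X.partition.measurable i).prod (X.partition.measurable j)

theorem integrable_block (X : ColouredGraphon k) (i j : Fin k) :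
    Integrable (X.block i j) volume :=
  X.graphon.integrable.indicator₀ (X.nullMeasurableSet_prod i j)

theorem block_pullback (X : ColouredGraphon k) (φ : MeasPresMap) (i j : Fin k) (p : I × I) :
    (X.pullback φ).block i j p = X.block i j (φ.1 p.1, φ.1 p.2) := rfl

end ColouredGraphon

/-! ### The distance `d_□^{(k)}` is a pseudometric -/

/-- The sum `∑_{i,j} |∫_{C×D} (1_{A_i×A_j} U - 1_{B_i×B_j} V)|`. -/
noncomputable def cutSum (X Y : ColouredGraphon k) (C D : Set I) : ℝ :=
  ∑ i : Fin k, ∑ j : Fin k, |∫ p in C ×ˢ D, (X.block i j p - Y.block i j p)|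

/-- The supremum term of `d_□^{(k)}`. -/
noncomputable def cutPart (X Y : ColouredGraphon k) : ℝ :=
  ⨆ CD : LebSet × LebSet, cutSum X Y CD.1.1 CD.2.1

/-- The term `∑_i λ(A_i △ B_i)` of `d_□^{(k)}`. -/
noncomputable def colourPart (X Y : ColouredGraphon k) : ℝ :=
  ∑ i : Fin k, (volume (X.partition.part i ∆ Y.partition.part i)).toReal

theorem colouredCutNormDist_eq (X Y : ColouredGraphon k) :
    colouredCutNormDist X Y = cutPart X Y + colourPart X Y := rfl

theorem cutSum_nonneg (X Y : ColouredGraphon k) (C D : Set I) : 0 ≤ cutSum X Y C D :=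
  Finset.sum_nonneg fun _ _ => Finset.sum_nonneg fun _ _ => abs_nonneg _

theorem colourPart_nonneg (X Y : ColouredGraphon k) : 0 ≤ colourPart X Y :=
  Finset.sum_nonneg fun _ _ => ENNReal.toReal_nonneg

theorem cutSum_le (X Y : ColouredGraphon k) (C D : Set I) : cutSum X Y C D ≤ k * k := by
  have h : ∀ i j : Fin k, |∫ p in C ×ˢ D, (X.block i j p - Y.block i j p)| ≤ 1 := fun i j => by
    have := norm_setIntegral_le_of_norm_le_const (μ := (volume : Measure (I × I)))
      (s := C ×ˢ D) (C := 1) (f := fun p => X.block i j p - Y.block i j p) (measure_lt_top _ _)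
      (fun p _ => by
        have h1 := X.block_mem_Icc i j p
        have h2 := Y.block_mem_Icc i j p
        rw [Real.norm_eq_abs, abs_le]
        constructor <;> linarith [h1.1, h1.2, h2.1, h2.2])
    exact this.trans (by rw [one_mul]; exact measureReal_le_one)
  calc cutSum X Y C D ≤ ∑ _i : Fin k, ∑ _j : Fin k, (1 : ℝ) :=
        Finset.sum_le_sum fun i _ => Finset.sum_le_sum fun j _ => h i j
    _ = k * k := by simp

theorem cutSum_le_cutPart (X Y : ColouredGraphon k) {C D : Set I}
    (hC : NullMeasurableSet C volume) (hD : NullMeasurableSet D volume) :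
    cutSum X Y C D ≤ cutPart X Y :=
  le_ciSup (f := fun CD : LebSet × LebSet => cutSum X Y CD.1.1 CD.2.1)
    ⟨k * k, by rintro _ ⟨CD, rfl⟩; exact cutSum_le X Y _ _⟩ (⟨C, hC⟩, ⟨D, hD⟩)

theorem cutPart_le {X Y : ColouredGraphon k} {B : ℝ}
    (h : ∀ C D, NullMeasurableSet C volume → NullMeasurableSet D volume → cutSum X Y C D ≤ B) :
    cutPart X Y ≤ B := by
  have : Nonempty (LebSet × LebSet) := ⟨(⟨∅, .empty⟩, ⟨∅, .empty⟩)⟩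
  exact ciSup_le fun CD => h _ _ CD.1.2 CD.2.2

theorem cutPart_nonneg (X Y : ColouredGraphon k) : 0 ≤ cutPart X Y :=
  (cutSum_nonneg X Y ∅ ∅).trans (cutSum_le_cutPart X Y .empty .empty)

theorem colouredCutNormDist_nonneg (X Y : ColouredGraphon k) : 0 ≤ colouredCutNormDist X Y :=
  add_nonneg (cutPart_nonneg X Y) (colourPart_nonneg X Y)

theorem cutSum_self (X : ColouredGraphon k) (C D : Set I) : cutSum X X C D = 0 := by
  simp [cutSum]

theorem colouredCutNormDist_self (X : ColouredGraphon k) : colouredCutNormDist X X = 0 := by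
  simp [colouredCutNormDist_eq, cutPart, cutSum_self, colourPart]

theorem cutSum_comm (X Y : ColouredGraphon k) (C D : Set I) :
    cutSum X Y C D = cutSum Y X C D := by
  refine Finset.sum_congr rfl fun i _ => Finset.sum_congr rfl fun j _ => ?_
  rw [← abs_neg, ← integral_neg]
  simp

theorem colouredCutNormDist_comm (X Y : ColouredGraphon k) :
    colouredCutNormDist X Y = colouredCutNormDist Y X := by
  simp only [colouredCutNormDist_eq, cutPart, colourPart, cutSum_comm X Y, symmDiff_comm]

theorem cutSum_triangle (X Y Z : ColouredGraphon k) (C D : Set I) :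
    cutSum X Z C D ≤ cutSum X Y C D + cutSum Y Z C D := by
  simp only [cutSum, ← Finset.sum_add_distrib]
  refine Finset.sum_le_sum fun i _ => Finset.sum_le_sum fun j _ => ?_
  rw [integral_sub (X.integrable_block i j).integrableOn (Y.integrable_block i j).integrableOn,
    integral_sub (Y.integrable_block i j).integrableOn (Z.integrable_block i j).integrableOn,
    integral_sub (X.integrable_block i j).integrableOn (Z.integrable_block i j).integrableOn]
  exact abs_sub_le _ _ _

theorem colourPart_triangle (X Y Z : ColouredGraphon k) :
    colourPart X Z ≤ colourPart X Y + colourPart Y Z := by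
  simp only [colourPart, ← Finset.sum_add_distrib]
  refine Finset.sum_le_sum fun i _ => ?_
  rw [← ENNReal.toReal_add (measure_ne_top _ _) (measure_ne_top _ _)]
  exact ENNReal.toReal_mono (by finiteness) (measure_symmDiff_le _ _ _)

theorem colouredCutNormDist_triangle (X Y Z : ColouredGraphon k) :
    colouredCutNormDist X Z ≤ colouredCutNormDist X Y + colouredCutNormDist Y Z := by
  have h : cutPart X Z ≤ cutPart X Y + cutPart Y Z := cutPart_le fun C D hC hD =>
    (cutSum_triangle X Y Z C D).trans
      (add_le_add (cutSum_le_cutPart X Y hC hD) (cutSum_le_cutPart Y Z hC hD))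
  have h' := colourPart_triangle X Y Z
  simp only [colouredCutNormDist_eq]
  linarith

/-! ### Invariance under the joint law -/

open MeasPresMap in
theorem colourPart_pullback (X Y : ColouredGraphon k) (φ ψ : MeasPresMap) :
    colourPart (X.pullback φ) (Y.pullback ψ) =
      ∑ i, (law φ ψ ((Prod.fst ⁻¹' X.partition.part i) ∆
        (Prod.snd ⁻¹' Y.partition.part i))).toReal := by
  refine Finset.sum_congr rfl fun i _ => ?_
  have h1 : NullMeasurableSet (Prod.fst ⁻¹' X.partition.part i) (law φ ψ) :=
    (X.partition.measurable i).preimage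
      (MeasurePreserving.quasiMeasurePreserving ⟨measurable_fst, map_fst_law φ ψ⟩)
  have h2 : NullMeasurableSet (Prod.snd ⁻¹' Y.partition.part i) (law φ ψ) :=
    (Y.partition.measurable i).preimage
      (MeasurePreserving.quasiMeasurePreserving ⟨measurable_snd, map_snd_law φ ψ⟩)
  have h3 : NullMeasurableSet ((Prod.fst ⁻¹' X.partition.part i) ∆
      (Prod.snd ⁻¹' Y.partition.part i)) (law φ ψ) := (h1.diff h2).union (h2.diff h1)
  conv_rhs => rw [law]
  rw [Measure.map_apply₀ (aemeasurable_prodMk φ ψ) h3]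
  rfl

/-- The integrand of the coupled cut norm of `X` and `Y`, on pairs of points of `[0,1]²`. -/
noncomputable def coupledBlock (X Y : ColouredGraphon k) (ij : Fin k × Fin k)
    (p : (I × I) × (I × I)) : ℝ :=
  X.block ij.1 ij.2 (p.1.1, p.2.1) - Y.block ij.1 ij.2 (p.1.2, p.2.2)

open MeasPresMap in
theorem integrable_coupledBlock (X Y : ColouredGraphon k) (ij : Fin k × Fin k)
    (φ ψ : MeasPresMap) :
    Integrable (coupledBlock X Y ij) ((law φ ψ).prod (law φ ψ)) := by
  have h1 : MeasurePreserving Prod.fst (law φ ψ) volume := ⟨measurable_fst, map_fst_law φ ψ⟩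
  have h2 : MeasurePreserving Prod.snd (law φ ψ) volume := ⟨measurable_snd, map_snd_law φ ψ⟩
  exact ((h1.prod h1).integrable_comp_of_integrable (X.integrable_block ij.1 ij.2)).sub
    ((h2.prod h2).integrable_comp_of_integrable (Y.integrable_block ij.1 ij.2))

theorem cutSum_pullback_eq (X Y : ColouredGraphon k) (φ ψ : MeasPresMap) {T : I → I × I}
    (hT : ∀ᵐ x, (φ.1 x, ψ.1 x) = T x) (C D : Set I) :
    cutSum (X.pullback φ) (Y.pullback ψ) C D =
      ∑ ij, |∫ p in C ×ˢ D, coupledBlock X Y ij (T p.1, T p.2)| := by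
  rw [Fintype.sum_prod_type]
  refine Finset.sum_congr rfl fun i _ => Finset.sum_congr rfl fun j _ => ?_
  congr 1
  refine integral_congr_ae (ae_restrict_of_ae ?_)
  have e1 := (Measure.quasiMeasurePreserving_fst (μ := (volume : Measure I))
    (ν := (volume : Measure I))).ae hT
  have e2 := (Measure.quasiMeasurePreserving_snd (μ := (volume : Measure I))
    (ν := (volume : Measure I))).ae hT
  filter_upwards [e1, e2] with p h1 h2
  simp only [coupledBlock, ← h1, ← h2, ColouredGraphon.block_pullback]

open MeasPresMap in
/-- The distance `d_□^{(k)}(X^φ, Y^ψ)` depends on `φ` and `ψ` only through their joint law. -/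
theorem colouredCutNormDist_pullback_le_of_law_eq (X Y : ColouredGraphon k)
    {φ ψ φ' ψ' : MeasPresMap} (h : law φ' ψ' = law φ ψ) :
    colouredCutNormDist (X.pullback φ') (Y.pullback ψ') ≤
      colouredCutNormDist (X.pullback φ) (Y.pullback ψ) := by
  rw [colouredCutNormDist_eq, colouredCutNormDist_eq, colourPart_pullback, colourPart_pullback, h]
  refine add_le_add_left (cutPart_le fun C D hC hD => ?_) _
  obtain ⟨T, hT, hTe⟩ := exists_ae_eq_measurePreserving φ ψ
  obtain ⟨T', hT', hTe'⟩ := exists_ae_eq_measurePreserving φ' ψ'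
  rw [h] at hT'
  rw [cutSum_pullback_eq X Y φ' ψ' hTe']
  refine sum_abs_setIntegral_comp_le hT' (fun ij => integrable_coupledBlock X Y ij φ ψ)
    (fun C D hC hD => ?_) hC hD
  refine le_trans (le_of_eq ?_) (cutSum_le_cutPart _ _ (hT.measurable hC).nullMeasurableSet
    (hT.measurable hD).nullMeasurableSet)
  rw [cutSum_pullback_eq X Y φ ψ hTe]
  refine Finset.sum_congr rfl fun ij _ => ?_
  have hTT := hT.prod hT
  have hi := integrable_coupledBlock X Y ij φ ψ
  conv_lhs => rw [← hTT.map_eq]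
  rw [setIntegral_map (hC.prod hD) (by rw [hTT.map_eq]; exact hi.1) hTT.measurable.aemeasurable]
  rfl

/-! ### The cut distance `δ_□^{(k)}` is a pseudometric -/

theorem colouredCutDist_le (X Y : ColouredGraphon k) (φ ψ : MeasPresMap) :
    colouredCutDist X Y ≤ colouredCutNormDist (X.pullback φ) (Y.pullback ψ) :=
  ciInf_le (f := fun φψ : MeasPresMap × MeasPresMap =>
    colouredCutNormDist (X.pullback φψ.1) (Y.pullback φψ.2))
    ⟨0, by rintro _ ⟨φψ, rfl⟩; exact colouredCutNormDist_nonneg _ _⟩ (φ, ψ)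

theorem exists_pullback_lt_of_colouredCutDist_lt {X Y : ColouredGraphon k} {r : ℝ}
    (h : colouredCutDist X Y < r) :
    ∃ φ ψ : MeasPresMap, colouredCutNormDist (X.pullback φ) (Y.pullback ψ) < r := by
  obtain ⟨φψ, hφψ⟩ := exists_lt_of_ciInf_lt h
  exact ⟨φψ.1, φψ.2, hφψ⟩

/-- A sequence of coloured graphons can be realised on one copy of `[0,1]` so that all
consecutive cut-norm distances are simultaneously almost optimal. -/
theorem exists_pullback_chain (X : ℕ → ColouredGraphon k) (r : ℕ → ℝ)
    (h : ∀ n, colouredCutDist (X n) (X (n + 1)) < r n) :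
    ∃ Z : ℕ → MeasPresMap, ∀ n,
      colouredCutNormDist ((X n).pullback (Z n)) ((X (n + 1)).pullback (Z (n + 1))) < r n := by
  choose φ ψ hφψ using fun n => exists_pullback_lt_of_colouredCutDist_lt (h n)
  obtain ⟨Z, hZ⟩ := MeasPresMap.exists_chain φ ψ
  exact ⟨Z, fun n => (colouredCutNormDist_pullback_le_of_law_eq _ _ (hZ n)).trans_lt (hφψ n)⟩

theorem colouredCutDist_nonneg (X Y : ColouredGraphon k) : 0 ≤ colouredCutDist X Y :=
  le_ciInf fun _ => colouredCutNormDist_nonneg _ _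

theorem colouredCutDist_self (X : ColouredGraphon k) : colouredCutDist X X = 0 :=
  ((colouredCutDist_le X X .id .id).trans (colouredCutNormDist_self _).le).antisymm
    (colouredCutDist_nonneg X X)

theorem colouredCutDist_comm (X Y : ColouredGraphon k) :
    colouredCutDist X Y = colouredCutDist Y X := by
  have h : ∀ X Y : ColouredGraphon k, colouredCutDist X Y ≤ colouredCutDist Y X := fun X Y =>
    le_ciInf fun φψ => (colouredCutDist_le X Y φψ.2 φψ.1).trans
      (colouredCutNormDist_comm _ _).le
  exact (h X Y).antisymm (h Y X)

theorem colouredCutDist_triangle (X Y Z : ColouredGraphon k) :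
    colouredCutDist X Z ≤ colouredCutDist X Y + colouredCutDist Y Z := by
  refine le_of_forall_pos_lt_add fun ε hε => ?_
  -- the chain lemma is applied to the sequence `X, Y, Z, Z, …`
  let W : ℕ → ColouredGraphon k := fun n => if n = 0 then X else if n = 1 then Y else Z
  obtain ⟨φ, hφ⟩ := exists_pullback_chain W
    (fun n => colouredCutDist (W n) (W (n + 1)) + ε / 2) fun n => by linarith
  have h0 := hφ 0
  have h1 := hφ 1
  simp only [W] at h0 h1
  norm_num at h0 h1
  have := colouredCutNormDist_triangle (X.pullback (φ 0)) (Y.pullback (φ 1)) (Z.pullback (φ 2))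
  linarith [colouredCutDist_le X Z (φ 0) (φ 2)]

end

open Filter Topology

section
variable {k : ℕ}

/-! ### Weak limits of graphons and limits of partitions -/

/-- Weak compactness of the set of `[0,1]`-valued functions, along an ultrafilter: by the
Banach-Alaoglu and Riesz theorems in `L²`. -/
theorem exists_weak_limit {Ω : Type*} [MeasurableSpace Ω] {μ : Measure Ω} [IsProbabilityMeasure μ]
    (𝓕 : Ultrafilter ℕ) (f : ℕ → Ω → ℝ) (hf : ∀ n, AEStronglyMeasurable (f n) μ)
    (h01 : ∀ n x, f n x ∈ Icc (0 : ℝ) 1) :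
    ∃ g : Ω → ℝ, Measurable g ∧ (∀ᵐ x ∂μ, g x ∈ Icc (0 : ℝ) 1) ∧
      ∀ s, NullMeasurableSet s μ →
        Tendsto (fun n => ∫ x in s, f n x ∂μ) 𝓕 (𝓝 (∫ x in s, g x ∂μ)) := by
  have hb : ∀ n, ∀ᵐ x ∂μ, ‖f n x‖ ≤ 1 := fun n => ae_of_all _ fun x => by
    rw [Real.norm_eq_abs, abs_le]
    exact ⟨by linarith [(h01 n x).1], (h01 n x).2⟩
  have hL : ∀ n, MemLp (f n) 2 μ := fun n => MemLp.of_bound (hf n) 1 (hb n)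
  have hfi : ∀ n, Integrable (f n) μ := fun n => Integrable.of_bound (hf n) 1 (hb n)
  let F : ℕ → Lp ℝ 2 μ := fun n => (hL n).toLp
  have hF : ∀ n, ‖F n‖ ≤ 1 := fun n => by
    refine (Lp.norm_le_of_ae_bound (C := 1) zero_le_one ?_).trans ?_
    · filter_upwards [(hL n).coeFn_toLp, hb n] with x h1 h2
      rwa [h1]
    · simp [measureUnivNNReal]
  let Φ : ℕ → WeakDual ℝ (Lp ℝ 2 μ) := fun n => StrongDual.toWeakDual (innerSL ℝ (F n))
  have hΦ : ∀ n, Φ n ∈ WeakDual.toStrongDual ⁻¹'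
      Metric.closedBall (0 : StrongDual ℝ (Lp ℝ 2 μ)) 1 := fun n => by
    rw [mem_preimage, mem_closedBall_zero_iff]
    exact (innerSL_apply_norm ℝ (F n)).trans_le (hF n)
  obtain ⟨ℓ, -, hℓ⟩ := (WeakDual.isCompact_closedBall (𝕜 := ℝ) (E := Lp ℝ 2 μ) 0
    1).ultrafilter_le_nhds
    (𝓕.map Φ) (le_principal_iff.2 (Filter.mem_map.2 (univ_mem' hΦ)))
  let G : Lp ℝ 2 μ := (InnerProductSpace.toDual ℝ (Lp ℝ 2 μ)).symm (WeakDual.toStrongDual ℓ)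
  have hlim : ∀ s, MeasurableSet s →
      Tendsto (fun n => ∫ x in s, f n x ∂μ) 𝓕 (𝓝 (∫ x in s, G x ∂μ)) := by
    intro s hs
    have h1 : Tendsto (fun n => Φ n (indicatorConstLp 2 hs (measure_ne_top μ s) (1 : ℝ))) 𝓕
        (𝓝 (ℓ (indicatorConstLp 2 hs (measure_ne_top μ s) (1 : ℝ)))) :=
      ((WeakDual.eval_continuous _).tendsto ℓ).comp hℓ
    have h2 : ℓ (indicatorConstLp 2 hs (measure_ne_top μ s) (1 : ℝ)) = ∫ x in s, G x ∂μ := by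
      rw [← L2.inner_indicatorConstLp_one (𝕜 := ℝ) hs (measure_ne_top μ s), real_inner_comm]
      exact (InnerProductSpace.toDual_symm_apply).symm
    rw [h2] at h1
    refine h1.congr fun n => ?_
    have h3 : Φ n (indicatorConstLp 2 hs (measure_ne_top μ s) (1 : ℝ)) = ∫ x in s, F n x ∂μ := by
      rw [← L2.inner_indicatorConstLp_one (𝕜 := ℝ) hs (measure_ne_top μ s), real_inner_comm]
      rfl
    rw [h3]
    exact integral_congr_ae (ae_restrict_of_ae (hL n).coeFn_toLp)
  have hGi : Integrable G μ := (Lp.memLp G).integrable (by norm_num)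
  refine ⟨G, (Lp.stronglyMeasurable G).measurable, ?_, fun s hs => ?_⟩
  · have h0 : 0 ≤ᵐ[μ] G := ae_nonneg_of_forall_setIntegral_nonneg hGi fun s hs _ =>
      ge_of_tendsto' (hlim s hs) fun n => integral_nonneg fun x => (h01 n x).1
    have h1 : G ≤ᵐ[μ] fun _ => 1 := by
      refine ae_le_of_forall_setIntegral_le hGi (integrable_const 1) fun s hs _ => ?_
      exact le_of_tendsto' (hlim s hs) fun n => integral_mono (hfi n).integrableOn
        (integrable_const 1) fun x => (h01 n x).2
    filter_upwards [h0, h1] with x h0 h1 using ⟨h0, h1⟩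
  · have e : toMeasurable μ s =ᵐ[μ] s := hs.toMeasurable_ae_eq
    have := hlim _ (measurableSet_toMeasurable μ s)
    simpa only [setIntegral_congr_set e] using this

/-- The weak limit of graphons is truncated and symmetrised in order to satisfy the conditions on a
graphon everywhere; since the limit has values in `[0,1]` almost everywhere and each `U n` is
symmetric, this does not affect integrals over rectangles. -/
theorem Graphon.exists_weak_limit (𝓕 : Ultrafilter ℕ) (U : ℕ → Graphon) :
    ∃ W : Graphon, ∀ C D : Set I, NullMeasurableSet C volume → NullMeasurableSet D volume →
      Tendsto (fun n => ∫ p in C ×ˢ D, (U n).toFun p.1 p.2) 𝓕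
        (𝓝 (∫ p in C ×ˢ D, W.toFun p.1 p.2)) := by
  obtain ⟨V, hV, hV01, hlim⟩ := _root_.exists_weak_limit (μ := (volume : Measure (I × I))) 𝓕
    (fun n p => (U n).toFun p.1 p.2) (fun n => (U n).integrable.1)
    fun n p => (U n).mem_Icc _ _
  have hVi : Integrable V volume := Integrable.of_bound hV.aestronglyMeasurable 1
    (hV01.mono fun p hp => by
      rw [Real.norm_eq_abs, abs_le]
      exact ⟨by linarith [hp.1], hp.2⟩)
  have hswap : MeasurePreserving (Prod.swap : I × I → I × I) volume volume :=
    Measure.measurePreserving_swap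
  refine ⟨⟨fun x y => max 0 (min 1 ((V (x, y) + V (y, x)) / 2)), fun x y => ?_, fun x y => ?_, ?_⟩,
    fun C D hC hD => ?_⟩
  · exact ⟨le_max_left _ _, max_le zero_le_one (min_le_left _ _)⟩
  · rw [add_comm]
  · refine Measurable.nullMeasurable ?_
    have h' : Measurable fun p : I × I => V (p.2, p.1) := hV.comp measurable_swap
    exact measurable_const.max (measurable_const.min ((hV.add h').div_const 2))
  · have h1 := hlim _ (hC.prod hD)
    have h2 := hlim _ (hD.prod hC)
    have e : ∫ p in C ×ˢ D, max 0 (min 1 ((V (p.1, p.2) + V (p.2, p.1)) / 2)) =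
        ((∫ p in C ×ˢ D, V p) + ∫ p in D ×ˢ C, V p) / 2 := by
      have hs : ∫ p in D ×ˢ C, V p = ∫ p in C ×ˢ D, V p.swap :=
        (setIntegral_prod_swap (μ := (volume : Measure I)) (ν := (volume : Measure I)) D C V).symm
      have hVs : Integrable (fun p : I × I => V p.swap) volume :=
        hswap.integrable_comp_of_integrable hVi
      rw [hs, ← integral_add hVi.integrableOn hVs.integrableOn, ← integral_div]
      refine integral_congr_ae (ae_restrict_of_ae ?_)
      filter_upwards [hV01, hswap.quasiMeasurePreserving.ae hV01] with p h1 h2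
      change max 0 (min 1 ((V p + V p.swap) / 2)) = (V p + V p.swap) / 2
      rw [min_eq_right (by linarith [h1.2, h2.2]), max_eq_right (by linarith [h1.1, h2.1])]
    rw [e]
    refine ((h1.add h2).div_const 2).congr fun n => ?_
    have hs : ∫ p in D ×ˢ C, (U n).toFun p.1 p.2 = ∫ p in C ×ˢ D, (U n).toFun p.1 p.2 := by
      refine (setIntegral_prod_swap (μ := (volume : Measure I)) (ν := (volume : Measure I)) D C
        fun p => (U n).toFun p.1 p.2).symm.trans ?_
      simp only [Prod.fst_swap, Prod.snd_swap, (U n).symm]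
      rfl
    rw [hs, add_self_div_two]

/-- Partitions at summable consecutive distances converge. Each point goes to the part to which it
eventually belongs; the null set of points without such a part is coloured as in `A 0`. -/
theorem MeasPartition.exists_limit (A : ℕ → MeasPartition k)
    (h : ∀ n, ∑ i, (volume ((A n).part i ∆ (A (n + 1)).part i)).toReal ≤ (1 / 2) ^ n) :
    ∃ B : MeasPartition k, ∀ n i,
      (volume ((A n).part i ∆ B.part i)).toReal ≤ 2 * (1 / 2) ^ n := by
  -- points whose colour is eventually `i`
  let L : Fin k → Set I := fun i => ⋃ n, ⋂ m, (A (n + m)).part i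
  have hLm : ∀ i, NullMeasurableSet (L i) volume := fun i =>
    .iUnion fun n => .iInter fun m => (A (n + m)).measurable i
  have hLd : ∀ i j, i ≠ j → Disjoint (L i) (L j) := fun i j hij => by
    rw [disjoint_left]
    intro x hi hj
    simp only [L, mem_iUnion, mem_iInter] at hi hj
    obtain ⟨n, hn⟩ := hi
    obtain ⟨m, hm⟩ := hj
    exact disjoint_left.1 ((A (n + m)).disjoint i j hij) (hn m) (add_comm m n ▸ hm n)
  refine ⟨⟨fun i => L i ∪ ((⋃ j, L j)ᶜ ∩ (A 0).part i), fun i => ?_, fun i j hij => ?_, ?_⟩,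
    fun n i => ?_⟩
  · exact (hLm i).union ((NullMeasurableSet.iUnion hLm).compl.inter ((A 0).measurable i))
  · have h1 : ∀ i, L i ⊆ ⋃ j, L j := fun i => subset_iUnion L i
    rw [disjoint_left]
    rintro x (hx | hx) (hy | hy)
    · exact disjoint_left.1 (hLd i j hij) hx hy
    · exact hy.1 (h1 _ hx)
    · exact hx.1 (h1 _ hy)
    · exact disjoint_left.1 ((A 0).disjoint i j hij) hx.2 hy.2
  · refine eq_univ_of_forall fun x => ?_
    rw [mem_iUnion]
    by_cases hx : x ∈ ⋃ j, L j
    · obtain ⟨j, hj⟩ := mem_iUnion.1 hx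
      exact ⟨j, .inl hj⟩
    · obtain ⟨j, hj⟩ := mem_iUnion.1 ((A 0).cover.ge (mem_univ x))
      exact ⟨j, .inr ⟨hx, hj⟩⟩
  -- outside `N` the colour does not change from index `n` on
  · let N : Set I := ⋃ m, ⋃ j, (A (n + m)).part j ∆ (A (n + m + 1)).part j
    have hconst : ∀ x ∉ N, ∀ j m, x ∈ (A (n + m)).part j ↔ x ∈ (A n).part j := by
      intro x hx j m
      induction m with
      | zero => rfl
      | succ m ih =>
        rw [← ih]
        simp only [N, mem_iUnion, not_exists, mem_symmDiff] at hx
        have := hx m j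
        rw [← add_assoc]
        tauto
    have hsub : (A n).part i ∆ (L i ∪ ((⋃ j, L j)ᶜ ∩ (A 0).part i)) ⊆ N := by
      intro x hx
      by_contra hxN
      have hL : ∀ j, x ∈ L j ↔ x ∈ (A n).part j := by
        refine fun j => ⟨fun hj => ?_, fun hj => ?_⟩
        · simp only [L, mem_iUnion, mem_iInter] at hj
          obtain ⟨m, hm⟩ := hj
          exact (hconst x hxN j m).1 (add_comm m n ▸ hm n)
        · exact mem_iUnion.2 ⟨n, mem_iInter.2 fun m => (hconst x hxN j m).2 hj⟩
      obtain ⟨j, hj⟩ := mem_iUnion.1 ((A n).cover.ge (mem_univ x))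
      have hU : x ∈ ⋃ j, L j := mem_iUnion.2 ⟨j, (hL j).2 hj⟩
      simp only [mem_symmDiff, mem_union, mem_inter_iff, mem_compl_iff, hU, hL] at hx
      tauto
    have hN : volume N ≤ ENNReal.ofReal (2 * (1 / 2) ^ n) := by
      have hs : HasSum (fun m : ℕ => (1 / 2 : ℝ) ^ n * (1 / 2) ^ m) ((1 / 2) ^ n * 2) :=
        hasSum_geometric_two.mul_left _
      calc volume N ≤ ∑' m, ∑ j, volume ((A (n + m)).part j ∆ (A (n + m + 1)).part j) :=
            (measure_iUnion_le _).trans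
              (ENNReal.tsum_le_tsum fun m => measure_iUnion_fintype_le _ _)
        _ ≤ ∑' m, ENNReal.ofReal ((1 / 2) ^ n * (1 / 2) ^ m) := by
            refine ENNReal.tsum_le_tsum fun m => ?_
            rw [ENNReal.le_ofReal_iff_toReal_le
              (ENNReal.sum_ne_top.2 fun _ _ => by finiteness) (by positivity),
              ENNReal.toReal_sum (fun _ _ => by finiteness), ← pow_add]
            exact h (n + m)
        _ = ENNReal.ofReal (2 * (1 / 2) ^ n) := by
            rw [← ENNReal.ofReal_tsum_of_nonneg (fun m => by positivity) hs.summable, hs.tsum_eq,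
              mul_comm]
    exact ENNReal.toReal_le_of_le_ofReal (by positivity) ((measure_mono hsub).trans hN)

/-! ### Completeness -/

/-- An integral of a function bounded by `b` and supported on `S` is at most `b λ(S)`. -/
theorem abs_setIntegral_le_of_support {Ω : Type*} [MeasurableSpace Ω] {μ : Measure Ω}
    [IsFiniteMeasure μ] {h : Ω → ℝ} (hi : Integrable h μ) {S : Set Ω} (hS : NullMeasurableSet S μ)
    {b : ℝ} (hb : ∀ x ∈ S, |h x| ≤ b) (h0 : ∀ x ∉ S, h x = 0) (K : Set Ω) :
    |∫ x in K, h x ∂μ| ≤ b * μ.real S := by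
  calc |∫ x in K, h x ∂μ| ≤ ∫ x in K, |h x| ∂μ := abs_integral_le_integral_abs
    _ ≤ ∫ x, |h x| ∂μ := setIntegral_le_integral hi.abs (ae_of_all _ fun x => abs_nonneg _)
    _ ≤ ∫ x, S.indicator (fun _ => b) x ∂μ := by
        refine integral_mono hi.abs ((integrable_const b).indicator₀ hS) fun x => ?_
        by_cases hx : x ∈ S
        · simpa only [indicator_of_mem hx] using hb x hx
        · simp [indicator_of_notMem hx, h0 x hx]
    _ = b * μ.real S := by rw [integral_indicator₀ hS, setIntegral_const, smul_eq_mul, mul_comm]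

theorem measureReal_fst_union_snd_le {E E' : Set I} :
    (volume : Measure (I × I)).real (Prod.fst ⁻¹' E ∪ Prod.snd ⁻¹' E') ≤
      volume.real E + volume.real E' := by
  refine (measureReal_union_le _ _).trans (le_of_eq ?_)
  rw [← prod_univ, ← univ_prod, Measure.real, Measure.real,
    show (volume : Measure (I × I)) = (volume : Measure I).prod volume from rfl,
    Measure.prod_prod, Measure.prod_prod]
  simp [Measure.real]

/-- Blocks depend continuously on the colouring, uniformly in the graphon. -/
theorem abs_setIntegral_block_sub_le (U : Graphon) (A B : MeasPartition k) (i j : Fin k)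
    (K : Set (I × I)) :
    |(∫ p in K, (ColouredGraphon.mk U A).block i j p) -
      ∫ p in K, (ColouredGraphon.mk U B).block i j p| ≤
      volume.real (A.part i ∆ B.part i) + volume.real (A.part j ∆ B.part j) := by
  have hA := (ColouredGraphon.mk U A).integrable_block i j
  have hB := (ColouredGraphon.mk U B).integrable_block i j
  have hm : ∀ i, NullMeasurableSet (A.part i ∆ B.part i) volume := fun i =>
    ((A.measurable i).diff (B.measurable i)).union ((B.measurable i).diff (A.measurable i))
  rw [← integral_sub hA.integrableOn hB.integrableOn]
  refine (abs_setIntegral_le_of_support (b := 1) (hA.sub hB)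
    (((hm i).preimage Measure.quasiMeasurePreserving_fst).union
      ((hm j).preimage Measure.quasiMeasurePreserving_snd)) (fun p _ => ?_) (fun p hp => ?_)
    K).trans ?_
  · have h1 := (ColouredGraphon.mk U A).block_mem_Icc i j p
    have h2 := (ColouredGraphon.mk U B).block_mem_Icc i j p
    rw [abs_le]
    constructor <;> simp only [Pi.sub_apply] <;> linarith [h1.1, h1.2, h2.1, h2.2]
  · simp only [mem_union, mem_preimage, mem_symmDiff, not_or, not_and, not_not] at hp
    have : p ∈ A.part i ×ˢ A.part j ↔ p ∈ B.part i ×ˢ B.part j := by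
      simp only [mem_prod]; tauto
    simp only [ColouredGraphon.block, Pi.sub_apply]
    by_cases hp : p ∈ A.part i ×ˢ A.part j
    · rw [indicator_of_mem hp, indicator_of_mem (this.1 hp), sub_self]
    · rw [indicator_of_notMem hp, indicator_of_notMem (this.not.1 hp), sub_self]
  · rw [one_mul]
    exact measureReal_fst_union_snd_le

theorem ColouredGraphon.setIntegral_indicator_part (X : ColouredGraphon k) (f : I × I → ℝ)
    (i j : Fin k) (C D : Set I) :
    ∫ p in C ×ˢ D, (X.partition.part i ×ˢ X.partition.part j).indicator f p =
      ∫ p in (X.partition.part i ∩ C) ×ˢ (X.partition.part j ∩ D), f p := by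
  have hm : NullMeasurableSet (X.partition.part i ×ˢ X.partition.part j)
      ((volume : Measure (I × I)).restrict (C ×ˢ D)) :=
    (X.nullMeasurableSet_prod i j).mono Measure.restrict_le_self
  rw [integral_indicator₀ hm, Measure.restrict_restrict₀ hm, prod_inter_prod]

/-- The distance `d_□^{(k)}` is complete: the limit consists of a weak limit of the graphons and the
limit of the partitions. Distances to the limit are controlled by distances within the sequence,
each integral over a rectangle being continuous along the ultrafilter. -/
theorem exists_colouredCutNormDist_limit (Y : ℕ → ColouredGraphon k)
    (h : ∀ n, colouredCutNormDist (Y n) (Y (n + 1)) ≤ (1 / 2) ^ n) :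
    ∃ Z : ColouredGraphon k, ∀ n,
      colouredCutNormDist (Y n) Z ≤ 2 * (1 / 2) ^ n + k * (2 * (1 / 2) ^ n) := by
  have hYY : ∀ n m,
      colouredCutNormDist (Y n) (Y (n + m)) ≤ 2 * (1 / 2) ^ n * (1 - (1 / 2) ^ m) := by
    intro n m
    induction m with
    | zero => simp [colouredCutNormDist_self]
    | succ m ih =>
      have h1 := colouredCutNormDist_triangle (Y n) (Y (n + m)) (Y (n + m + 1))
      have h2 := h (n + m)
      rw [pow_add] at h2
      rw [← add_assoc, pow_succ]
      linarith
  let 𝓕 : Ultrafilter ℕ := hyperfilter ℕ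
  have h𝓕 : (𝓕 : Filter ℕ) ≤ atTop := Nat.hyperfilter_le_atTop
  obtain ⟨W, hW⟩ := Graphon.exists_weak_limit 𝓕 fun n => (Y n).graphon
  obtain ⟨B, hB⟩ := MeasPartition.exists_limit (fun n => (Y n).partition) fun n =>
    (le_add_of_nonneg_left (cutPart_nonneg _ _)).trans (h n)
  let Z : ColouredGraphon k := ⟨W, B⟩
  have hgeom : Tendsto (fun n : ℕ => (2 : ℝ) * (1 / 2) ^ n) 𝓕 (𝓝 0) := by
    have := (tendsto_pow_atTop_nhds_zero_of_lt_one (r := (1 / 2 : ℝ)) (by norm_num)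
      (by norm_num)).const_mul 2
    rw [mul_zero] at this
    exact this.mono_left h𝓕
  have hblock : ∀ C D, NullMeasurableSet C volume → NullMeasurableSet D volume → ∀ i j,
      Tendsto (fun n => ∫ p in C ×ˢ D, (Y n).block i j p) 𝓕
        (𝓝 (∫ p in C ×ˢ D, Z.block i j p)) := by
    intro C D hC hD i j
    have h1 : Tendsto (fun n => ∫ p in C ×ˢ D, (ColouredGraphon.mk (Y n).graphon B).block i j p) 𝓕
        (𝓝 (∫ p in C ×ˢ D, Z.block i j p)) := by
      have hs : ∀ U : Graphon, ∫ p in C ×ˢ D, (ColouredGraphon.mk U B).block i j p =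
          ∫ p in (B.part i ∩ C) ×ˢ (B.part j ∩ D), U.toFun p.1 p.2 := fun U =>
        ColouredGraphon.setIntegral_indicator_part ⟨U, B⟩ _ i j C D
      simp only [Z, hs]
      exact hW _ _ ((B.measurable i).inter hC) ((B.measurable j).inter hD)
    have h2 : Tendsto (fun n => (∫ p in C ×ˢ D, (Y n).block i j p) -
        ∫ p in C ×ˢ D, (ColouredGraphon.mk (Y n).graphon B).block i j p) 𝓕 (𝓝 0) := by
      have hg := hgeom.add hgeom
      rw [add_zero] at hg
      exact squeeze_zero_norm (fun n => (abs_setIntegral_block_sub_le (Y n).graphon (Y n).partition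
        B i j (C ×ˢ D)).trans (add_le_add (hB n i) (hB n j))) hg
    simpa using h2.add h1
  refine ⟨Z, fun n => ?_⟩
  rw [colouredCutNormDist_eq]
  refine add_le_add (cutPart_le fun C D hC hD => ?_) ?_
  · have hlim : Tendsto (fun m => cutSum (Y n) (Y m) C D) 𝓕 (𝓝 (cutSum (Y n) Z C D)) := by
      refine tendsto_finsetSum _ fun i _ => tendsto_finsetSum _ fun j _ => Tendsto.abs ?_
      have hs : ∀ X : ColouredGraphon k, ∫ p in C ×ˢ D, ((Y n).block i j p - X.block i j p) =
          (∫ p in C ×ˢ D, (Y n).block i j p) - ∫ p in C ×ˢ D, X.block i j p := fun X =>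
        integral_sub ((Y n).integrable_block i j).integrableOn (X.integrable_block i j).integrableOn
      simp only [hs]
      exact tendsto_const_nhds.sub (hblock C D hC hD i j)
    refine le_of_tendsto hlim (h𝓕 (eventually_atTop.2 ⟨n, fun m hm => ?_⟩))
    obtain ⟨m, rfl⟩ := Nat.exists_eq_add_of_le hm
    calc cutSum (Y n) (Y (n + m)) C D ≤ cutPart (Y n) (Y (n + m)) := cutSum_le_cutPart _ _ hC hD
      _ ≤ colouredCutNormDist (Y n) (Y (n + m)) := le_add_of_nonneg_right (colourPart_nonneg _ _)
      _ ≤ 2 * (1 / 2) ^ n * (1 - (1 / 2) ^ m) := hYY n m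
      _ ≤ 2 * (1 / 2) ^ n := mul_le_of_le_one_right (by positivity)
          (sub_le_self _ (by positivity))
  · refine (Finset.sum_le_sum fun i _ => hB n i).trans ?_
    simp

/-- A sequence whose consecutive cut distances decay geometrically converges in cut distance. -/
theorem exists_colouredCutDist_limit (X : ℕ → ColouredGraphon k)
    (h : ∀ n, colouredCutDist (X n) (X (n + 1)) < (1 / 2) ^ n) :
    ∃ Z : ColouredGraphon k, Tendsto (fun n => colouredCutDist (X n) Z) atTop (𝓝 0) := by
  obtain ⟨φ, hφ⟩ := exists_pullback_chain X _ h
  obtain ⟨Z, hZ⟩ := exists_colouredCutNormDist_limit (fun n => (X n).pullback (φ n))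
    fun n => (hφ n).le
  refine ⟨Z, squeeze_zero (fun n => colouredCutDist_nonneg _ _)
    (fun n => (colouredCutDist_le (X n) Z (φ n) .id).trans (hZ n)) ?_⟩
  have := (tendsto_pow_atTop_nhds_zero_of_lt_one (r := (1 / 2 : ℝ)) (by norm_num)
    (by norm_num)).const_mul 2
  have h2 := this.add (this.const_mul (k : ℝ))
  simpa using h2

/-! ### Weak regularity -/

/-- Removing `t 1_S` from `G` changes the energy by `-2 t ∫_S G + t² λ(S)`. -/
theorem integral_sub_indicator_sq {Ω : Type*} [MeasurableSpace Ω] {μ : Measure Ω}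
    [IsFiniteMeasure μ] {G : Ω → ℝ} (hG : Integrable G μ) (hG2 : Integrable (fun p => G p ^ 2) μ)
    {S : Set Ω} (hS : NullMeasurableSet S μ) (t : ℝ) :
    ∫ p, (G p - t * S.indicator (fun _ => 1) p) ^ 2 ∂μ =
      ∫ p, G p ^ 2 ∂μ - 2 * t * ∫ p in S, G p ∂μ + t ^ 2 * μ.real S := by
  have h1 : Integrable (S.indicator G) μ := hG.indicator₀ hS
  have h2 : Integrable (S.indicator fun _ => (1 : ℝ)) μ := (integrable_const 1).indicator₀ hS
  have e : ∀ p, (G p - t * S.indicator (fun _ => 1) p) ^ 2 =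
      G p ^ 2 - 2 * t * S.indicator G p + t ^ 2 * S.indicator (fun _ => 1) p := fun p => by
    by_cases hp : p ∈ S
    · simp only [indicator_of_mem hp]; ring
    · simp only [indicator_of_notMem hp]; ring
  simp only [e]
  have h3 : Integrable (fun p => G p ^ 2 - 2 * t * S.indicator G p) μ := hG2.sub (h1.const_mul _)
  rw [integral_add h3 (h2.const_mul _), integral_sub hG2 (h1.const_mul _), integral_const_mul,
    integral_const_mul, integral_indicator₀ hS, integral_indicator₀ hS,
    setIntegral_const]
  simp

/-- The error `U - ∑_{l<n} ε w_l 1_{C_l×D_l}` of approximating `U` by a combination of rectangles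
with coefficients in `{-ε, 0, ε}`. -/
noncomputable def Graphon.residual (U : Graphon) (ε : ℝ) (w : ℕ → SignType) (C D : ℕ → Set I)
    (n : ℕ) (p : I × I) : ℝ :=
  U.toFun p.1 p.2 - ∑ l ∈ Finset.range n, ε * w l * (C l ×ˢ D l).indicator (fun _ => 1) p

namespace Graphon

theorem residual_succ (U : Graphon) (ε : ℝ) (w : ℕ → SignType) (C D : ℕ → Set I) (n : ℕ)
    (p : I × I) : U.residual ε w C D (n + 1) p =
      U.residual ε w C D n p - ε * w n * (C n ×ˢ D n).indicator (fun _ => 1) p := by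
  simp only [residual, Finset.sum_range_succ]
  ring

theorem integrable_residual (U : Graphon) (ε : ℝ) (w : ℕ → SignType) {C D : ℕ → Set I}
    (hC : ∀ l, NullMeasurableSet (C l) volume) (hD : ∀ l, NullMeasurableSet (D l) volume) (n : ℕ) :
    Integrable (U.residual ε w C D n) volume :=
  U.integrable.sub (integrable_finsetSum _ fun l _ =>
    ((integrable_const 1).indicator₀ ((hC l).prod (hD l))).const_mul _)

theorem exists_bound_residual (U : Graphon) (ε : ℝ) (w : ℕ → SignType) (C D : ℕ → Set I) (n : ℕ) :
    ∃ M, ∀ p, |U.residual ε w C D n p| ≤ M := by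
  induction n with
  | zero =>
    refine ⟨1, fun p => ?_⟩
    simp only [residual, Finset.range_zero, Finset.sum_empty, sub_zero]
    exact abs_le.2 ⟨by linarith [(U.mem_Icc p.1 p.2).1], (U.mem_Icc p.1 p.2).2⟩
  | succ n ih =>
    obtain ⟨M, hM⟩ := ih
    refine ⟨M + |ε * w n|, fun p => ?_⟩
    rw [residual_succ]
    refine (abs_sub _ _).trans (add_le_add (hM p) ?_)
    rw [abs_mul]
    refine mul_le_of_le_one_right (abs_nonneg _) ?_
    by_cases hp : p ∈ C n ×ˢ D n
    · simp [indicator_of_mem hp]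
    · simp [indicator_of_notMem hp]

/-- Energy decrement: after `n` greedy steps, either the residual has cut norm at most `ε`, or its
energy has dropped to at most `1 - n ε²`. -/
theorem exists_greedy (U : Graphon) {ε : ℝ} (hε : 0 < ε) (n : ℕ) :
    ∃ (w : ℕ → SignType) (C D : ℕ → Set I), (∀ l, NullMeasurableSet (C l) volume) ∧
      (∀ l, NullMeasurableSet (D l) volume) ∧
      ((∀ C' D', NullMeasurableSet C' volume → NullMeasurableSet D' volume →
        |∫ p in C' ×ˢ D', U.residual ε w C D n p| ≤ ε) ∨
      ∫ p, U.residual ε w C D n p ^ 2 ≤ 1 - n * ε ^ 2) := by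
  induction n with
  | zero =>
    refine ⟨0, fun _ => ∅, fun _ => ∅, fun _ => .empty, fun _ => .empty, .inr ?_⟩
    have h1 : ∀ p : I × I, U.residual ε 0 (fun _ => ∅) (fun _ => ∅) 0 p ^ 2 ≤ 1 := fun p => by
      simp only [residual, Finset.range_zero, Finset.sum_empty, sub_zero]
      exact pow_le_one₀ (U.mem_Icc _ _).1 (U.mem_Icc _ _).2
    refine (integral_mono_of_nonneg (ae_of_all _ fun p => sq_nonneg _) (integrable_const (1 : ℝ))
      (ae_of_all _ h1)).trans ?_
    simp
  | succ n ih =>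
    obtain ⟨w, C, D, hC, hD, h⟩ := ih
    by_cases hcut : ∀ C' D', NullMeasurableSet C' volume → NullMeasurableSet D' volume →
        |∫ p in C' ×ˢ D', U.residual ε w C D n p| ≤ ε
    -- nothing is left to improve: a zero coefficient is appended
    · refine ⟨Function.update w n 0, C, D, hC, hD, .inl fun C' D' hC' hD' => ?_⟩
      have e : ∀ p, U.residual ε (Function.update w n 0) C D (n + 1) p =
          U.residual ε w C D n p := fun p => by
        rw [residual_succ]
        simp only [residual, Function.update_self, SignType.coe_zero, mul_zero, zero_mul, sub_zero]
        congr 1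
        exact Finset.sum_congr rfl fun l hl => by
          rw [Function.update_of_ne (Finset.mem_range.1 hl).ne]
      simp only [e]
      exact hcut C' D' hC' hD'
    · have henergy := h.resolve_left hcut
      push Not at hcut
      obtain ⟨C', D', hC', hD', hlt⟩ := hcut
      set J := ∫ p in C' ×ˢ D', U.residual ε w C D n p with hJ
      refine ⟨Function.update w n (SignType.sign J), Function.update C n C',
        Function.update D n D', fun l => ?_, fun l => ?_, .inr ?_⟩
      · rcases eq_or_ne l n with rfl | hl
        · rwa [Function.update_self]
        · rw [Function.update_of_ne hl]; exact hC l
      · rcases eq_or_ne l n with rfl | hl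
        · rwa [Function.update_self]
        · rw [Function.update_of_ne hl]; exact hD l
      · have e : ∀ p, U.residual ε (Function.update w n (SignType.sign J)) (Function.update C n C')
            (Function.update D n D') (n + 1) p = U.residual ε w C D n p -
            ε * SignType.sign J * (C' ×ˢ D').indicator (fun _ => 1) p := fun p => by
          rw [residual_succ]
          simp only [residual, Function.update_self]
          congr 2
          exact Finset.sum_congr rfl fun l hl => by
            rw [Function.update_of_ne (Finset.mem_range.1 hl).ne,
              Function.update_of_ne (Finset.mem_range.1 hl).ne,
              Function.update_of_ne (Finset.mem_range.1 hl).ne]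
        have hi := U.integrable_residual ε w hC hD n
        obtain ⟨M, hM⟩ := U.exists_bound_residual ε w C D n
        have hi2 : Integrable (fun p => U.residual ε w C D n p ^ 2) volume :=
          Integrable.of_bound (hi.1.pow 2) (M ^ 2) (ae_of_all _ fun p => by
            rw [Real.norm_eq_abs, abs_pow]
            exact pow_le_pow_left₀ (abs_nonneg _) (hM p) 2)
        simp only [e]
        rw [integral_sub_indicator_sq hi hi2 (hC'.prod hD'), ← hJ]
        have hs : (SignType.sign J : ℝ) * J = |J| := sign_mul_self J
        have hs2 : (SignType.sign J : ℝ) ^ 2 ≤ 1 := by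
          rcases SignType.sign J <;> simp
        have hS : (volume : Measure (I × I)).real (C' ×ˢ D') ≤ 1 := measureReal_le_one
        have h3 : (ε * SignType.sign J) ^ 2 * (volume : Measure (I × I)).real (C' ×ˢ D') ≤
            ε ^ 2 := by
          rw [mul_pow]
          exact (mul_le_of_le_one_right (by positivity) hS).trans
            (mul_le_of_le_one_right (by positivity) hs2)
        have h4 : 2 * (ε * SignType.sign J) * J = 2 * ε * |J| := by rw [← hs]; ring
        rw [h4]
        push_cast
        nlinarith

end Graphon

/-- The weak regularity lemma of Frieze and Kannan, in the form used for total boundedness: up to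
an error `ε` in cut norm, every graphon is a step function whose matrix of values is taken from a
finite list not depending on the graphon. -/
theorem exists_step_approximation {ε : ℝ} (hε : 0 < ε) :
    ∃ (ρ τ : Type) (_ : Fintype ρ) (_ : Fintype τ) (r : ρ → τ → τ → ℝ), ∀ U : Graphon,
      ∃ (s : ρ) (q : I → τ), (∀ a, NullMeasurableSet (q ⁻¹' {a}) volume) ∧
        ∀ C D, NullMeasurableSet C volume → NullMeasurableSet D volume →
          |∫ p in C ×ˢ D, (U.toFun p.1 p.2 - r s (q p.1) (q p.2))| ≤ ε := by
  classical
  -- the energy, at most `1` at the start, cannot drop by more than `1`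
  obtain ⟨n, hn⟩ := exists_nat_gt (1 / ε ^ 2)
  refine ⟨Fin n → SignType, (Fin n → Prop) × (Fin n → Prop), inferInstance, inferInstance,
    fun w a b => ∑ l, ε * w l * if a.1 l ∧ b.2 l then 1 else 0, fun U => ?_⟩
  obtain ⟨w, C, D, hC, hD, h⟩ := U.exists_greedy hε n
  refine ⟨fun l => w l, fun x => (fun l => x ∈ C l, fun l => x ∈ D l), fun a => ?_,
    fun C' D' hC' hD' => ?_⟩
  · have hset : ∀ (E : Set I) (P : Prop), NullMeasurableSet E volume →
        NullMeasurableSet {x | (x ∈ E) = P} volume := fun E P hE => by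
      by_cases hP : P
      · simpa [hP] using hE
      · simp only [hP, eq_iff_iff, iff_false]
        exact hE.compl
    have e : (fun x => ((fun l : Fin n => x ∈ C l, fun l : Fin n => x ∈ D l) :
        (Fin n → Prop) × (Fin n → Prop))) ⁻¹' {a} =
        (⋂ l : Fin n, {x | (x ∈ C l) = a.1 l}) ∩ ⋂ l : Fin n, {x | (x ∈ D l) = a.2 l} := by
      ext x
      simp only [mem_preimage, mem_singleton_iff, Prod.ext_iff, funext_iff, mem_inter_iff,
        mem_iInter, mem_ofPred_eq]
    rw [e]
    exact (NullMeasurableSet.iInter fun l : Fin n => hset _ _ (hC l)).inter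
      (NullMeasurableSet.iInter fun l : Fin n => hset _ _ (hD l))
  · have hres : ∀ p : I × I, U.toFun p.1 p.2 - ∑ l : Fin n, ε * (w l : ℝ) *
        (if p.1 ∈ C l ∧ p.2 ∈ D l then 1 else 0) = U.residual ε w C D n p := fun p => by
      rw [Graphon.residual, ← Fin.sum_univ_eq_sum_range
        (fun l => ε * (w l : ℝ) * (C l ×ˢ D l).indicator (fun _ => (1 : ℝ)) p) n]
      simp only [indicator_apply, mem_prod]
    simp only [hres]
    refine h.resolve_right (fun henergy => ?_) C' D' hC' hD'
    have h1 : 0 ≤ ∫ p, U.residual ε w C D n p ^ 2 := integral_nonneg fun p => sq_nonneg _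
    rw [div_lt_iff₀ (by positivity)] at hn
    linarith

/-! ### Comparing coloured graphons through step functions -/

theorem integrable_comp_of_finite {τ : Type*} [Fintype τ] {q : I → τ}
    (hq : ∀ a, NullMeasurableSet (q ⁻¹' {a}) volume) (r : τ → τ → ℝ) {b : ℝ}
    (hr : ∀ a a', |r a a'| ≤ b) :
    Integrable (fun p : I × I => r (q p.1) (q p.2)) volume := by
  have hm : NullMeasurable (fun p : I × I => r (q p.1) (q p.2)) volume := fun s _ => by
    have e : (fun p : I × I => r (q p.1) (q p.2)) ⁻¹' s =
        ⋃ a, ⋃ a', ⋃ (_ : r a a' ∈ s), (q ⁻¹' {a}) ×ˢ (q ⁻¹' {a'}) := by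
      ext p
      simp
    rw [e]
    exact .iUnion fun a => .iUnion fun a' => .iUnion fun _ => (hq a).prod (hq a')
  exact Integrable.of_bound hm.aemeasurable.aestronglyMeasurable b (ae_of_all _ fun p => hr _ _)

theorem abs_setIntegral_pullback_le {F : I × I → ℝ} (hF : Integrable F volume) {B : ℝ}
    (hB : ∀ C D, NullMeasurableSet C volume → NullMeasurableSet D volume →
      |∫ p in C ×ˢ D, F p| ≤ B) (φ : MeasPresMap) {C D : Set I}
    (hC : NullMeasurableSet C volume) (hD : NullMeasurableSet D volume) :
    |∫ p in C ×ˢ D, F (φ.1 p.1, φ.1 p.2)| ≤ B := by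
  have hφ := φ.2.aemeasurable
  have hT : MeasurePreserving (hφ.mk φ.1) volume volume :=
    ⟨hφ.measurable_mk, by rw [← Measure.map_congr hφ.ae_eq_mk, φ.2.map_eq]⟩
  have e : ∫ p in C ×ˢ D, F (φ.1 p.1, φ.1 p.2) =
      ∫ p in C ×ˢ D, F (hφ.mk φ.1 p.1, hφ.mk φ.1 p.2) := by
    refine integral_congr_ae (ae_restrict_of_ae ?_)
    have e1 := (Measure.quasiMeasurePreserving_fst (μ := (volume : Measure I))
      (ν := (volume : Measure I))).ae hφ.ae_eq_mk
    have e2 := (Measure.quasiMeasurePreserving_snd (μ := (volume : Measure I))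
      (ν := (volume : Measure I))).ae hφ.ae_eq_mk
    filter_upwards [e1, e2] with p h1 h2
    rw [h1, h2]
  rw [e]
  have := sum_abs_setIntegral_comp_le (ι := Unit) (F := fun _ => F) hT (fun _ => hF) (B := B)
    (fun C D hC hD => by
      rw [Fintype.sum_unique]
      exact hB C D hC.nullMeasurableSet hD.nullMeasurableSet) hC hD
  rw [Fintype.sum_unique] at this
  exact this

section Step
variable {τ : Type*} [Fintype τ]

/-- If a graphon is close to a step function in cut norm, then so is each block of a colouring
that is constant on the steps, also after a pull-back. -/
theorem abs_setIntegral_block_sub_step_le (X : ColouredGraphon k) {q : I → τ}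
    (hq : ∀ a, NullMeasurableSet (q ⁻¹' {a}) volume) (c : τ → Fin k)
    (hc : ∀ x i, x ∈ X.partition.part i ↔ c (q x) = i) (r : τ → τ → ℝ) {b ε : ℝ}
    (hr : ∀ a a', |r a a'| ≤ b)
    (hX : ∀ C D, NullMeasurableSet C volume → NullMeasurableSet D volume →
      |∫ p in C ×ˢ D, (X.graphon.toFun p.1 p.2 - r (q p.1) (q p.2))| ≤ ε)
    (φ : MeasPresMap) (i j : Fin k) {C D : Set I}
    (hC : NullMeasurableSet C volume) (hD : NullMeasurableSet D volume) :
    |∫ p in C ×ˢ D, ((X.pullback φ).block i j p -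
      if c (q (φ.1 p.1)) = i ∧ c (q (φ.1 p.2)) = j then r (q (φ.1 p.1)) (q (φ.1 p.2)) else 0)| ≤
      ε := by
  have e : ∀ p, ((X.pullback φ).block i j p -
      if c (q (φ.1 p.1)) = i ∧ c (q (φ.1 p.2)) = j then r (q (φ.1 p.1)) (q (φ.1 p.2)) else 0) =
      ((X.pullback φ).partition.part i ×ˢ (X.pullback φ).partition.part j).indicator
        (fun p => X.graphon.toFun (φ.1 p.1) (φ.1 p.2) - r (q (φ.1 p.1)) (q (φ.1 p.2))) p := by
    intro p
    have hp : p ∈ (X.pullback φ).partition.part i ×ˢ (X.pullback φ).partition.part j ↔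
        c (q (φ.1 p.1)) = i ∧ c (q (φ.1 p.2)) = j := by
      rw [mem_prod, ← hc, ← hc]
      rfl
    unfold ColouredGraphon.block
    by_cases h : c (q (φ.1 p.1)) = i ∧ c (q (φ.1 p.2)) = j
    · rw [if_pos h, indicator_of_mem (hp.2 h), indicator_of_mem (hp.2 h)]
      rfl
    · rw [if_neg h, indicator_of_notMem (hp.not.2 h), indicator_of_notMem (hp.not.2 h), sub_zero]
  simp only [e]
  rw [ColouredGraphon.setIntegral_indicator_part]
  exact abs_setIntegral_pullback_le
    (X.graphon.integrable.sub (integrable_comp_of_finite hq r hr)) hX φ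
    (((X.pullback φ).partition.measurable i).inter hC)
    (((X.pullback φ).partition.measurable j).inter hD)

/-- Two graphons that are close to step functions with the same matrix `r` of values are close to
each other once their step maps `q` and `q'`, after pull-back, agree off a small set. -/
theorem colouredCutNormDist_pullback_le_of_step (X Y : ColouredGraphon k) {q q' : I → τ}
    (hq : ∀ a, NullMeasurableSet (q ⁻¹' {a}) volume)
    (hq' : ∀ a, NullMeasurableSet (q' ⁻¹' {a}) volume) (c : τ → Fin k)
    (hc : ∀ x i, x ∈ X.partition.part i ↔ c (q x) = i)
    (hc' : ∀ x i, x ∈ Y.partition.part i ↔ c (q' x) = i) (r : τ → τ → ℝ) {b ε η : ℝ} (hb : 0 ≤ b)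
    (hr : ∀ a a', |r a a'| ≤ b)
    (hX : ∀ C D, NullMeasurableSet C volume → NullMeasurableSet D volume →
      |∫ p in C ×ˢ D, (X.graphon.toFun p.1 p.2 - r (q p.1) (q p.2))| ≤ ε)
    (hY : ∀ C D, NullMeasurableSet C volume → NullMeasurableSet D volume →
      |∫ p in C ×ˢ D, (Y.graphon.toFun p.1 p.2 - r (q' p.1) (q' p.2))| ≤ ε)
    (φ ψ : MeasPresMap) (hη : volume.real {x | q (φ.1 x) ≠ q' (ψ.1 x)} ≤ η) :
    colouredCutNormDist (X.pullback φ) (Y.pullback ψ) ≤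
      k * (k * (ε + ε + 2 * b * (η + η))) + k * η := by
  set N : Set I := {x | q (φ.1 x) ≠ q' (ψ.1 x)} with hN
  have hqφ : ∀ a, NullMeasurableSet ((fun x => q (φ.1 x)) ⁻¹' {a}) volume := fun a =>
    (φ.2 _ (hq a)).1
  have hqψ : ∀ a, NullMeasurableSet ((fun x => q' (ψ.1 x)) ⁻¹' {a}) volume := fun a =>
    (ψ.2 _ (hq' a)).1
  have hNm : NullMeasurableSet N volume := by
    have e : N = (⋃ a, (fun x => q (φ.1 x)) ⁻¹' {a} ∩ (fun x => q' (ψ.1 x)) ⁻¹' {a})ᶜ := by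
      ext x
      simp [hN, eq_comm]
    rw [e]
    exact (NullMeasurableSet.iUnion fun a => (hqφ a).inter (hqψ a)).compl
  rw [colouredCutNormDist_eq]
  refine add_le_add (cutPart_le fun C D hC hD => ?_) ?_
  · have hij : ∀ i j, |∫ p in C ×ˢ D, ((X.pullback φ).block i j p - (Y.pullback ψ).block i j p)| ≤
        ε + ε + 2 * b * (η + η) := by
      intro i j
      -- the `(i, j)` block of the step function
      let g : τ → τ → ℝ := fun a a' => if c a = i ∧ c a' = j then r a a' else 0
      have hg : ∀ a a', |g a a'| ≤ b := fun a a' => by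
        simp only [g]
        split_ifs
        · exact hr a a'
        · simpa using hb
      have h1 := abs_setIntegral_block_sub_step_le X hq c hc r hr hX φ i j hC hD
      have h2 := abs_setIntegral_block_sub_step_le Y hq' c hc' r hr hY ψ i j hC hD
      have i1 := integrable_comp_of_finite hqφ g hg
      have i2 := integrable_comp_of_finite hqψ g hg
      have h3 := abs_setIntegral_le_of_support (i1.sub i2) (b := 2 * b)
        ((hNm.preimage (Measure.quasiMeasurePreserving_fst (ν := (volume : Measure I)))).union
          (hNm.preimage (Measure.quasiMeasurePreserving_snd (μ := (volume : Measure I)))))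
        (fun p _ => (abs_sub _ _).trans ((add_le_add (hg _ _) (hg _ _)).trans (two_mul b).ge))
        (fun p hp => by
          simp only [hN, mem_union, mem_preimage, mem_ofPred_eq, not_or, not_not] at hp
          simp only [Pi.sub_apply, hp.1, hp.2, sub_self]) (C ×ˢ D)
      have h4 := h3.trans (mul_le_mul_of_nonneg_left
        (measureReal_fst_union_snd_le.trans (add_le_add hη hη)) (by positivity))
      have b1 := ((X.pullback φ).integrable_block i j).integrableOn (s := C ×ˢ D)
      have b2 := ((Y.pullback ψ).integrable_block i j).integrableOn (s := C ×ˢ D)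
      simp only [Pi.sub_apply] at h4
      rw [integral_sub i1.integrableOn i2.integrableOn] at h4
      rw [integral_sub b1 i1.integrableOn] at h1
      rw [integral_sub b2 i2.integrableOn] at h2
      rw [integral_sub b1 b2]
      rw [abs_le] at *
      constructor <;> linarith [h1.1, h1.2, h2.1, h2.2, h4.1, h4.2]
    refine (Finset.sum_le_sum fun i _ => Finset.sum_le_sum fun j _ => hij i j).trans (le_of_eq ?_)
    simp only [Finset.sum_const, Finset.card_univ, Fintype.card_fin, nsmul_eq_mul]
  · refine (Finset.sum_le_sum fun i _ => (?_ : _ ≤ η)).trans (le_of_eq ?_)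
    · refine le_trans (measureReal_mono (μ := volume) (fun x hx => ?_)) hη
      intro hxe
      have h1 := hc (φ.1 x) i
      have h2 := hc' (ψ.1 x) i
      rw [hxe] at h1
      have h3 : x ∈ (X.pullback φ).partition.part i ↔ x ∈ (Y.pullback ψ).partition.part i :=
        h1.trans h2.symm
      rw [mem_symmDiff] at hx
      tauto
    · simp

end Step

/-! ### Total boundedness -/

/-- Two finitely valued maps whose laws nearly agree, coincide off a small set after composition
with suitable measure-preserving maps. -/
theorem exists_pullback_eq_off_small {τ : Type*} [Fintype τ] {q q' : I → τ}
    (hq : ∀ a, NullMeasurableSet (q ⁻¹' {a}) volume)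
    (hq' : ∀ a, NullMeasurableSet (q' ⁻¹' {a}) volume) {θ : ℝ} (hθ : 0 ≤ θ)
    (h : ∀ a, volume.real (q ⁻¹' {a}) ≤ volume.real (q' ⁻¹' {a}) + θ) :
    ∃ φ ψ : MeasPresMap,
      volume.real {x | q (φ.1 x) ≠ q' (ψ.1 x)} ≤ Fintype.card τ * θ := by
  obtain ⟨γ, h₁, h₂, hγ⟩ := exists_coupling_of_finite volume volume q q' hq hq'
  obtain ⟨φ, ψ, rfl⟩ := MeasPresMap.exists_law_eq γ h₁ h₂
  refine ⟨φ, ψ, ?_⟩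
  have hsum : ∑ a, volume (q ⁻¹' {a}) = 1 := by
    rw [← measure_univ (μ := (volume : Measure I)), ← preimage_univ (f := q),
      ← iUnion_of_singleton, preimage_iUnion, ← tsum_fintype (L := .unconditional τ)]
    exact (measure_iUnion₀ (fun a b hab => ((disjoint_singleton.2 hab).preimage q).aedisjoint)
      hq).symm
  have hle : ∀ a, volume (q ⁻¹' {a}) ≤
      min (volume (q ⁻¹' {a})) (volume (q' ⁻¹' {a})) + ENNReal.ofReal θ := fun a => by
    rw [min_add, le_min_iff]
    refine ⟨le_self_add, ?_⟩
    have := ENNReal.ofReal_le_ofReal (h a)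
    rwa [ENNReal.ofReal_add measureReal_nonneg hθ, ofReal_measureReal, ofReal_measureReal] at this
  have hbound : (1 : ENNReal) - ∑ a, min (volume (q ⁻¹' {a})) (volume (q' ⁻¹' {a})) ≤
      ENNReal.ofReal (Fintype.card τ * θ) := by
    rw [tsub_le_iff_left]
    calc (1 : ENNReal) = ∑ a, volume (q ⁻¹' {a}) := hsum.symm
      _ ≤ ∑ a, (min (volume (q ⁻¹' {a})) (volume (q' ⁻¹' {a})) + ENNReal.ofReal θ) :=
          Finset.sum_le_sum fun a _ => hle a
      _ = _ := by
          rw [Finset.sum_add_distrib, Finset.sum_const, Finset.card_univ, nsmul_eq_mul,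
            ENNReal.ofReal_mul (by positivity), ENNReal.ofReal_natCast]
  have hmap : volume {x | q (φ.1 x) ≠ q' (ψ.1 x)} ≤ MeasPresMap.law φ ψ {z | q z.1 ≠ q' z.2} :=
    Measure.le_map_apply (MeasPresMap.aemeasurable_prodMk φ ψ) _
  exact ENNReal.toReal_le_of_le_ofReal (by positivity) (hmap.trans (hγ.trans hbound))

/-- Total boundedness: a coloured graphon is described up to `δ` by the matrix of values of a step
approximation, and by the measures, rounded down to multiples of `1 / M`, of the parts of the joint
partition by colour and step. -/
theorem exists_finite_discretization (k : ℕ) {δ : ℝ} (hδ : 0 < δ) :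
    ∃ (β : Type) (_ : Fintype β) (F : ColouredGraphon k → β),
      ∀ X Y, F X = F Y → colouredCutDist X Y < δ := by
  classical
  have hε : 0 < δ / (4 * (k * k + 1)) := by positivity
  obtain ⟨ρ, τ, _, _, r, hr⟩ := exists_step_approximation hε
  set ε := δ / (4 * (k * k + 1)) with hεd
  choose s q hq hcut using fun X : ColouredGraphon k => hr X.graphon
  have hcol : ∀ (X : ColouredGraphon k) (x : I), ∃ i, x ∈ X.partition.part i := fun X x =>
    mem_iUnion.1 (X.partition.cover.ge (mem_univ x))
  choose c hc using hcol
  have hc' : ∀ X x i, x ∈ X.partition.part i ↔ c X x = i := fun X x i =>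
    ⟨fun hx => by_contra fun hne => disjoint_left.1 (X.partition.disjoint _ _ hne) (hc X x) hx,
      fun h => h ▸ hc X x⟩
  let b : ℝ := ∑ t, ∑ a, ∑ a', |r t a a'|
  have hb : 0 ≤ b := Finset.sum_nonneg fun _ _ => Finset.sum_nonneg fun _ _ =>
    Finset.sum_nonneg fun _ _ => abs_nonneg _
  have hrb : ∀ t a a', |r t a a'| ≤ b := fun t a a' =>
    ((Finset.single_le_sum (f := fun a' => |r t a a'|) (fun _ _ => abs_nonneg _)
      (Finset.mem_univ a')).trans (Finset.single_le_sum (f := fun a => ∑ a', |r t a a'|)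
      (fun _ _ => Finset.sum_nonneg fun _ _ => abs_nonneg _) (Finset.mem_univ a))).trans
      (Finset.single_le_sum (f := fun t => ∑ a, ∑ a', |r t a a'|) (fun _ _ =>
        Finset.sum_nonneg fun _ _ => Finset.sum_nonneg fun _ _ => abs_nonneg _) (Finset.mem_univ t))
  -- joint partition by colour and step
  let Q : ColouredGraphon k → I → Fin k × τ := fun X x => (c X x, q X x)
  have hQ : ∀ X a, NullMeasurableSet (Q X ⁻¹' {a}) volume := fun X a => by
    have e : Q X ⁻¹' {a} = X.partition.part a.1 ∩ q X ⁻¹' {a.2} := by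
      ext x
      simp only [Q, mem_preimage, mem_singleton_iff, Prod.ext_iff, mem_inter_iff, hc']
    rw [e]
    exact (X.partition.measurable _).inter (hq X _)
  let K : ℝ := k * (k * (2 * b * 2)) + k
  let T : ℝ := Fintype.card (Fin k × τ)
  -- the steps agree off a set of measure `T / M`, which contributes `K * (T / M) < δ / 2`
  obtain ⟨M, hM⟩ := exists_nat_gt (K * T * (2 / δ))
  have hK : 0 ≤ K := by positivity
  have hT : 0 ≤ T := by positivity
  have hM0 : (0 : ℝ) < M := lt_of_le_of_lt (by positivity) hM
  refine ⟨ρ × (Fin k × τ → Fin (M + 1)), inferInstance, fun X => (s X, fun a =>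
    ⟨⌊M * volume.real (Q X ⁻¹' {a})⌋₊, Nat.lt_succ_of_le (Nat.floor_le_of_le
      (mul_le_of_le_one_right (Nat.cast_nonneg M) measureReal_le_one))⟩), fun X Y hXY => ?_⟩
  rw [Prod.mk.injEq, funext_iff] at hXY
  obtain ⟨hs, hfl⟩ := hXY
  have hclose : ∀ a, volume.real (Q X ⁻¹' {a}) ≤ volume.real (Q Y ⁻¹' {a}) + 1 / M := fun a => by
    have h1 := Fin.mk.inj_iff.1 (hfl a)
    have h2 := Nat.lt_floor_add_one (M * volume.real (Q X ⁻¹' {a}))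
    have h3 := Nat.floor_le (a := M * volume.real (Q Y ⁻¹' {a})) (by positivity)
    rw [h1] at h2
    have h4 : M * volume.real (Q X ⁻¹' {a}) ≤ M * (volume.real (Q Y ⁻¹' {a}) + 1 / M) := by
      rw [mul_add, mul_one_div_cancel hM0.ne']
      linarith
    exact le_of_mul_le_mul_left h4 hM0
  obtain ⟨φ, ψ, hφψ⟩ := exists_pullback_eq_off_small (hQ X) (hQ Y) (by positivity) hclose
  have hd := colouredCutNormDist_pullback_le_of_step X Y (hQ X) (hQ Y) Prod.fst (hc' X) (hc' Y)
    (fun a a' => r (s X) a.2 a'.2) hb (fun a a' => hrb _ _ _) (hcut X) (hs ▸ hcut Y) φ ψ hφψ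
  refine (colouredCutDist_le X Y φ ψ).trans_lt (hd.trans_lt ?_)
  have h1 : K * (T * (1 / M)) < δ / 2 := by
    rw [← mul_assoc, mul_one_div, div_lt_iff₀ hM0]
    have : K * T * (2 / δ) * (δ / 2) < M * (δ / 2) := mul_lt_mul_of_pos_right hM (by positivity)
    rw [mul_assoc (K * T), div_mul_div_cancel₀ hδ.ne'] at this
    linarith
  have h2 : k * k * (2 * ε) ≤ δ / 2 := by
    have : ε * (4 * (k * k + 1)) = δ := div_mul_cancel₀ _ (by positivity)
    nlinarith
  have h3 : k * (k * (ε + ε + 2 * b * (T * (1 / M) + T * (1 / M)))) + k * (T * (1 / M)) =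
      k * k * (2 * ε) + K * (T * (1 / M)) := by
    simp only [K]
    ring
  exact (le_of_eq h3).trans_lt (by linarith)

end

/-! ### Compactness -/

/-- The pseudometric space of `k`-coloured graphons with the cut distance. -/
noncomputable abbrev colouredGraphonPseudoMetricSpace (k : ℕ) :
    PseudoMetricSpace (ColouredGraphon k) where
  dist := colouredCutDist
  dist_self := colouredCutDist_self
  dist_comm := colouredCutDist_comm
  dist_triangle := colouredCutDist_triangle

theorem compactSpace_colouredGraphon (k : ℕ) :
    @CompactSpace (ColouredGraphon k)
      (colouredGraphonPseudoMetricSpace k).toUniformSpace.toTopologicalSpace := by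
  let _ := colouredGraphonPseudoMetricSpace k
  have hcomplete : CompleteSpace (ColouredGraphon k) := by
    refine Metric.complete_of_convergent_controlled_sequences (fun n => (1 / 2 : ℝ) ^ n)
      (fun n => by positivity) fun X hX => ?_
    obtain ⟨Z, hZ⟩ := exists_colouredCutDist_limit X fun n => hX n n (n + 1) le_rfl (Nat.le_succ n)
    exact ⟨Z, tendsto_iff_dist_tendsto_zero.2 hZ⟩
  have htb : TotallyBounded (univ : Set (ColouredGraphon k)) := by
    refine Metric.totallyBounded_of_finite_discretization fun δ hδ => ?_
    obtain ⟨β, hβ, F, hF⟩ := exists_finite_discretization k hδ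
    exact ⟨β, hβ, fun X => F X, fun X Y h => hF X Y h⟩
  exact ⟨htb.isCompact_of_isClosed isClosed_univ⟩

theorem mainTheorem8 (k : ℕ) (hk : 1 ≤ k) :
    ∃ m : MetricSpace (ColouredGraphonQuotient k),
      (∀ X Y : ColouredGraphon k, m.dist X.toQuotient Y.toQuotient = colouredCutDist X Y) ∧
      @CompactSpace (ColouredGraphonQuotient k)
        m.toPseudoMetricSpace.toUniformSpace.toTopologicalSpace := by
  have hcongr : ∀ X Y Z : ColouredGraphon k, colouredCutDist Y Z = 0 →
      colouredCutDist X Y = colouredCutDist X Z := fun X Y Z h => by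
    have h1 := colouredCutDist_triangle X Y Z
    have h2 := colouredCutDist_triangle X Z Y
    rw [colouredCutDist_comm Z Y] at h2
    linarith
  let d : ColouredGraphonQuotient k → ColouredGraphonQuotient k → ℝ :=
    Quot.lift₂ colouredCutDist hcongr fun X Y Z h => by
      rw [colouredCutDist_comm X, colouredCutDist_comm Y, hcongr Z X Y h]
  let m : MetricSpace (ColouredGraphonQuotient k) :=
    { dist := d
      dist_self := by rintro ⟨X⟩; exact colouredCutDist_self X
      dist_comm := by rintro ⟨X⟩ ⟨Y⟩; exact colouredCutDist_comm X Y
      dist_triangle := by rintro ⟨X⟩ ⟨Y⟩ ⟨Z⟩; exact colouredCutDist_triangle X Y Z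
      eq_of_dist_eq_zero := by rintro ⟨X⟩ ⟨Y⟩ h; exact Quot.sound h }
  refine ⟨m, fun X Y => rfl, ?_⟩
  let _ := colouredGraphonPseudoMetricSpace k
  have := compactSpace_colouredGraphon k
  have hisom : Isometry (ColouredGraphon.toQuotient (k := k)) := Isometry.of_dist_eq fun X Y => rfl
  exact Function.Surjective.compactSpace hisom.continuous Quot.mk_surjective
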